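/- **Conventions.** All vector spaces are over $\mathbb K\in\{\mathbb R,\mathbb C\}$ and $\mathbb R^+=[0,\infty)$. A *bundle of $\Omega$-spaces* over a topological space $X$ consists of Hausdorff locally convex spaces $\mathfrak E_x$ ($x\in X$) with directed families of seminorms $\{\nu_j^x\}_{j\in J}$ (with $J$ independent of $x$, and directedness holding uniformly in $x$) and a topology on $\mathfrak E=\bigsqcup_x\mathfrak E_x$ such that the projection $\pi$ is continuous, addition (on the fibre product) and scalar multiplication are continuous, the values of the bounded continuous selections are dense in every $\mathfrak E_x$, and the tubes $\{w\in\mathfrak E_y: y\in O,\ \nu_j^y(w-\sigma(y))<\varepsilon\}$ ($O\subseteq X$ open, $\sigma$ a bounded continuous selection, $\varepsilon>0$, $j\in J$) form a base of neighbourhoods of every point of $\mathfrak E$. A selection $\sigma\in\prod_x\mathfrak E_x$ is *bounded* if $\sup_x\nu_j^x(\sigma(x))<\infty$ for all $j$. $\Gamma(\pi)$ is the set of bounded continuous selections and $\Gamma^{x}(\pi)$ the set of bounded selections that are continuous at $x$. A *Banach bundle* is a bundle of $\Omega$-spaces whose stalks are Banach spaces, whose only seminorm is the norm of the stalks, and for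 which $\|\cdot\|:\mathfrak E\to\mathbb R$ is continuous. The direct sum $\mathfrak V\oplus\mathfrak V$ has stalks $\mathfrak E_x\times\mathfrak E_x$ with norm $\|u\|+\|w\|$, and the topology in which the tubes around the selections in the linear span of $\{(\sigma,0),(0,\sigma):\sigma\in\Gamma(\pi)\}$ form bases of neighbourhoods. $\langle\mathcal T,x_\infty,\Phi\rangle$ is a *graph section* if $\mathcal T(x)\subseteq\mathfrak E_x\times\mathfrak E_x$ is the graph of a linear operator for all $x\in X$, $\Phi$ is a linear space of selections of $\mathfrak V\oplus\mathfrak V$ that are bounded and continuous at $x_\infty$, $\phi(x)\in\mathcal T(x)$ for all $x\in X$, $\phi\in\Phi$, and $\{\phi(x_\infty):\phi\in\Phi\}=\mathcal T(x_\infty)$. For $\mathcal E\subseteq\Gamma(\pi)$ and a set $\Theta$ of families $B=(B_x)_{x\in X}$ of bounded sets $B_x\subseteq\mathfrak E_x$ put $\mathbf D(B,\mathcal E)=\{v\in\mathcal E: v(x)\in B_x\ \forall x\}$ and $S_x=\{\{v(x):v\in\mathbf D(B,\mathcal E)\}: B\in\Theta\}$; let $\mathcal L_{S_x}(\mathfrak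 E_x)$ be the space of continuous linear operators on $\mathfrak E_x$ with the topology of uniform convergence on the members of $S_x$. $\langle\mathfrak V,\mathfrak W\rangle$ is a *$(\Theta,\mathcal E)$-structure* (with parameter space $\mathbb R^+$) if $\Theta\ne\emptyset$, $\mathbf D(B,\mathcal E)\neq\emptyset$ for $B\in\Theta$, $\bigcup S_x$ is total in $\mathfrak E_x$ for all $x$, and $\mathfrak W$ is a bundle of $\Omega$-spaces, with projection $\rho$, whose stalks $\mathfrak M_x$ are linear spaces of continuous maps $\mathbb R^+\to\mathcal L_{S_x}(\mathfrak E_x)$ with the seminorms $f\mapsto\max_{(K,B)\in O}\sup_{t\in K}\sup_{v\in\mathbf D(B,\mathcal E)}\|f(t)v(x)\|$, $O$ a finite set of pairs of a compact $K\subset\mathbb R^+$ and a $B\in\Theta$. $\Delta_\Theta\langle\mathfrak V,\mathfrak W\rangle(\mathcal E,X,\mathbb R^+)$ is the class of sets $\Omega$ of graph sections such that for every $\langle\mathcal T,x_\infty,\Phi\rangle\in\Omega$ there is a $\mathcal V\in\Gamma^{x_\infty}(\rho)$ for which each $\mathcal V(x)$ is an equicontinuous $C_0$-semigroup on $\mathfrak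 E_x$ whose generator has graph $\mathcal T(x)$. **Theorem.** Let $\mathfrak V$ be a Banach bundle over $X$, let $x_\infty\in X$ be a non-isolated point, $X_0=X\setminus\{x_\infty\}$, and for $x\in X_0$ let $\mathcal U_0(x)$ be a $C_0$-semigroup of contractions (respectively of isometries) on $\mathfrak E_x$ with generator $T_x$. Let $\Phi$ be the set of bounded selections $\phi=(\phi_1,\phi_2)$ of $\mathfrak V\oplus\mathfrak V$, continuous at $x_\infty$, with $\phi(x)\in\mathrm{Graph}(T_x)$ for all $x\in X_0$; let $\mathcal T(x)=\mathrm{Graph}(T_x)$ for $x\in X_0$, $\mathcal T(x_\infty)=\{\phi(x_\infty):\phi\in\Phi\}$, $D(T_{x_\infty})=\{\phi_1(x_\infty):\phi\in\Phi\}$ and $\mathcal R(\lambda-T_{x_\infty})=\{\lambda\phi_1(x_\infty)-\phi_2(x_\infty):\phi\in\Phi\}$. (1) If $D(T_{x_\infty})$ is dense in $\mathfrak E_{x_\infty}$ and $\mathcal R(\lambda_0-T_{x_\infty})$ is dense for some real $\lambda_0>0$ (respectively, both $\mathcal R(\lambda_0-T_{x_\infty})$ and $\mathcal R(\lambda_1-T_{x_\infty})$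 are dense for some $\lambda_0>0$ and some $\lambda_1<0$), then $\langle\mathcal T,x_\infty,\Phi\rangle$ is a graph section, and the operator $T_{x_\infty}:\phi_1(x_\infty)\mapsto\phi_2(x_\infty)$ with graph $\mathcal T(x_\infty)$ is the generator of a $C_0$-semigroup of contractions (respectively of isometries) on $\mathfrak E_{x_\infty}$. (2) Under the hypotheses of (1), let $\mathcal U(x)=\mathcal U_0(x)$ for $x\in X_0$ and let $\mathcal U(x_\infty)$ be the semigroup generated by $T_{x_\infty}$. Put $\mathcal E=\{v\in\Gamma(\pi):\exists\phi\in\Phi,\ v(x_\infty)=\phi_1(x_\infty)\}$ and $\Theta=\{(\{w(x)\})_{x\in X}:w\in\mathcal E\}$. Suppose that $\{v(x):v\in\mathcal E\}$ is dense in $\mathfrak E_x$ for all $x\in X_0$, that $\langle\mathfrak V,\mathfrak W\rangle$ is a $(\Theta,\mathcal E)$-structure with stalks $\mathfrak M_x$ such that for all $x\in X$, $f\in\mathfrak M_x$ and $\lambda>0$ the weak integral $\int_0^\infty e^{-\lambda s}f(s)\,ds$ exists in $\mathcal L_{S_x}(\mathfrak E_x)$, and that for all $x\in X$ the space $\mathfrak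 M_x$ contains all one-parameter semigroups $V:\mathbb R^+\to\mathcal L_{S_x}(\mathfrak E_x)$ that are continuous and satisfy $\|V(s)\|\le1$ for all $s$ (respectively, that are continuous and for which the topology of $\mathfrak E_x$ is defined by some family of seminorms all of which are preserved by every $V(s)$). For a selection $G$ of $\mathfrak W$ write $\mathfrak L(G)(x)(\lambda)=\int_0^\infty e^{-\lambda s}G(x)(s)\,ds$. Suppose that there is an $F\in\Gamma(\rho)$ with $F(x_\infty)=\mathcal U(x_\infty)$ such that (i) either, for all $\lambda>0$, all $G\in\Gamma^{x_\infty}(\rho)$ with $G(x_\infty)=F(x_\infty)$ and all $w\in\Gamma^{x_\infty}(\pi)$ with $w(x_\infty)=v(x_\infty)$ for some $v\in\mathcal E$, the selection $z\mapsto\mathfrak L(G)(z)(\lambda)w(z)$ is in $\Gamma^{x_\infty}(\pi)$; or, for all $\lambda>0$ and $v\in\mathcal E$, the selection $z\mapsto\mathfrak L(F)(z)(\lambda)v(z)$ is in $\Gamma(\pi)$; (ii) for every $v\in\mathcal E$ there is a $\phi\in\Phi$ with $\phi_1(x_\infty)=v(x_\infty)$ such that for every sequence $z_n\to x_\infty$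 in $X$ the functions $s\mapsto\mathcal U(z_n)(s)\phi_1(z_n)-F(z_n)(s)v(z_n)$ on $\mathbb R^+$ are bounded uniformly in $n$ and $s$, and are equicontinuous (uniformly in $n$) at every $s\in\mathbb R^+$; (iii) $X$ is metrizable. Then $\mathcal U(x)\in\mathfrak M_x$ for all $x\in X$; for all $v\in\mathcal E$ and all compact $K\subset\mathbb R^+$ $$\lim_{z\to x_\infty}\sup_{s\in K}\|\mathcal U(z)(s)v(z)-F(z)(s)v(z)\|=0;$$ $\mathcal U\in\Gamma^{x_\infty}(\rho)$; and $\{\langle\mathcal T,x_\infty,\Phi\rangle\}\in\Delta_\Theta\langle\mathfrak V,\mathfrak W\rangle(\mathcal E,X,\mathbb R^+)$. -/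

import Mathlib

open Filter Topology Set MeasureTheory
open scoped NNReal

namespace OmegaBundle

/-! ### Bundles of locally convex spaces and their selections -/

section Bundles

variable {X : Type*}

/-- The total space of a family of stalks. It carries no topology by default. -/
abbrev Tot (E : X → Type*) : Type _ := Bundle.TotalSpace PUnit.{1} E

/-- The data of a bundle with stalks `E x`: a family of functions (the seminorms) on every stalk,
indexed by the same set `J` for all stalks, and a topology on the total space. -/
structure Prebundle (E : X → Type*) (J : Type*) where
  /-- the seminorms -/
  sn : J → ∀ x, E x → ℝ
  /-- the topology of the total space -/
  top : TopologicalSpace (Tot E)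

/-- The map from the base space to the total space given by a selection. -/
def graphMap {E : X → Type*} (σ : ∀ x, E x) (x : X) : Tot E := ⟨x, σ x⟩

/-- The tube of radius `ε` around `σ` over `U`, with respect to the seminorm of index `j`. -/
def tube {E : X → Type*} [∀ x, AddCommGroup (E x)] {J : Type*} (sn : J → ∀ x, E x → ℝ)
    (U : Set X) (σ : ∀ x, E x) (ε : ℝ) (j : J) : Set (Tot E) :=
  {p | p.proj ∈ U ∧ sn j p.proj (p.snd - σ p.proj) < ε}

variable [TopologicalSpace X]

namespace Prebundle

variable {E : X → Type*} {J : Type*}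

/-- Bounded selections. -/
def IsBdd (P : Prebundle E J) (σ : ∀ x, E x) : Prop :=
  ∀ j, BddAbove (range fun x => P.sn j x (σ x))

/-- `Γ(π)`: the bounded continuous selections. -/
def Gamma (P : Prebundle E J) : Set (∀ x, E x) :=
  {σ | P.IsBdd σ ∧ @Continuous X (Tot E) _ P.top (graphMap σ)}

/-- `Γ^x(π)`: the bounded selections that are continuous at the point `x`. -/
def GammaAt (P : Prebundle E J) (x : X) : Set (∀ x, E x) :=
  {σ | P.IsBdd σ ∧ @ContinuousAt X (Tot E) _ P.top (graphMap σ) x}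

/-- Bundles of `Ω`-spaces: the seminorms make every stalk a Hausdorff locally convex space, the
operations are continuous on the total space, the values of the bounded continuous selections
are dense in every stalk, and the tubes around bounded continuous selections form a base of
neighbourhoods of every point of the total space. -/
structure IsOmegaBundle (𝕜 : Type*) [RCLike 𝕜] [∀ x, AddCommGroup (E x)] [∀ x, Module 𝕜 (E x)]
    (P : Prebundle E J) : Prop where
  seminorms : ∃ s : J → ∀ x, Seminorm 𝕜 (E x), ∀ j x v, s j x v = P.sn j x v
  directed : ∀ i j, ∃ k, ∀ x v, P.sn i x v ≤ P.sn k x v ∧ P.sn j x v ≤ P.sn k x v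
  separating : ∀ x (v : E x), (∀ j, P.sn j x v = 0) → v = 0
  continuous_proj : @Continuous (Tot E) X P.top _ Bundle.TotalSpace.proj
  /-- addition is continuous on the fibre product of the total space with itself -/
  continuous_add :
    @Continuous (Tot fun x => E x × E x) (Tot E)
      (TopologicalSpace.induced
        (fun p => ((⟨p.proj, p.snd.1⟩, ⟨p.proj, p.snd.2⟩) : Tot E × Tot E))
        (@instTopologicalSpaceProd _ _ P.top P.top))
      P.top (fun p => ⟨p.proj, p.snd.1 + p.snd.2⟩)
  continuous_smul :
    @Continuous (𝕜 × Tot E) (Tot E) (@instTopologicalSpaceProd _ _ _ P.top) P.top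
      (fun p => ⟨p.2.proj, p.1 • p.2.snd⟩)
  dense_sections : ∀ x (v : E x) (j : J) (ε : ℝ), 0 < ε →
    ∃ σ ∈ P.Gamma, P.sn j x (v - σ x) < ε
  nhds_iff : ∀ (p : Tot E) (s : Set (Tot E)), s ∈ @nhds _ P.top p ↔
    ∃ (U : Set X) (σ : ∀ x, E x) (ε : ℝ) (j : J), IsOpen U ∧ σ ∈ P.Gamma ∧ 0 < ε ∧
      p ∈ tube P.sn U σ ε j ∧ tube P.sn U σ ε j ⊆ s

end Prebundle

/-- The topology on the total space for which the tubes around the members of `𝒢`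
containing a point generate the neighbourhood filter of that point. -/
abbrev tubeTopology {E : X → Type*} [∀ x, AddCommGroup (E x)] {J : Type*} (sn : J → ∀ x, E x → ℝ)
    (𝒢 : Set (∀ x, E x)) : TopologicalSpace (Tot E) :=
  TopologicalSpace.generateFrom
    {T | ∃ (U : Set X) (σ : ∀ x, E x) (ε : ℝ) (j : J),
      IsOpen U ∧ σ ∈ 𝒢 ∧ 0 < ε ∧ T = tube sn U σ ε j}

/-- The direct sum of two bundles: the seminorms are the sums of a seminorm of the first and one
of the second bundle, and the topology is generated by the tubes around the
linear span of the sections of the two summands. -/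
def Prebundle.directSum (𝕜 : Type*) [RCLike 𝕜] {E₁ E₂ : X → Type*}
    [∀ x, AddCommGroup (E₁ x)] [∀ x, Module 𝕜 (E₁ x)]
    [∀ x, AddCommGroup (E₂ x)] [∀ x, Module 𝕜 (E₂ x)] {J₁ J₂ : Type*}
    (P : Prebundle E₁ J₁) (Q : Prebundle E₂ J₂) :
    Prebundle (fun x => E₁ x × E₂ x) (J₁ × J₂) where
  sn := fun ρ x v => P.sn ρ.1 x v.1 + Q.sn ρ.2 x v.2
  top := tubeTopology (J := J₁ × J₂) (fun ρ x v => P.sn ρ.1 x v.1 + Q.sn ρ.2 x v.2)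
    (Submodule.span 𝕜
      ({f | ∃ σ ∈ P.Gamma, f = fun x => (σ x, 0)} ∪ {f | ∃ σ ∈ Q.Gamma, f = fun x => (0, σ x)} :
        Set (∀ x, E₁ x × E₂ x)) : Set (∀ x, E₁ x × E₂ x))

end Bundles

/-! ### Banach bundles, graph sections -/

section Banach

variable {X : Type*} [TopologicalSpace X] {E : X → Type*} [∀ x, NormedAddCommGroup (E x)]

/-- The bundle with the norm of the stalks as only seminorm. -/
def normed (τ : TopologicalSpace (Tot E)) : Prebundle E PUnit.{1} where
  sn := fun _ _ v => ‖v‖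
  top := τ

variable (𝕜 : Type*) [RCLike 𝕜] [∀ x, NormedSpace 𝕜 (E x)]

/-- Banach bundles: the stalks are Banach spaces and the norm is continuous on the total space. -/
structure IsBanachBundle (τ : TopologicalSpace (Tot E)) : Prop where
  complete : ∀ x, CompleteSpace (E x)
  isOmegaBundle : (normed τ).IsOmegaBundle 𝕜
  continuous_norm : @Continuous (Tot E) ℝ τ _ (fun p => ‖p.snd‖)

/-- `⟨𝒯, x∞, Φ⟩ ∈ Graph(𝔙, 𝔙)`. -/
structure IsGraphSection (τ : TopologicalSpace (Tot E)) (𝒯 : ∀ x, Set (E x × E x)) (xinf : X)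
    (Φ : Set (∀ x, E x × E x)) : Prop where
  graph : ∀ x, ∃ A : E x →ₗ.[𝕜] E x, (A.graph : Set (E x × E x)) = 𝒯 x
  subset : Φ ⊆ ((normed τ).directSum 𝕜 (normed τ)).GammaAt xinf
  linear : ∃ L : Submodule 𝕜 (∀ x, E x × E x), (L : Set (∀ x, E x × E x)) = Φ
  inclusion : ∀ x, ∀ φ ∈ Φ, φ x ∈ 𝒯 x
  asymptotic : {p | ∃ φ ∈ Φ, φ xinf = p} = 𝒯 xinf

end Banach

/-! ### Semigroups of operators on a Banach space -/

section Semigroups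

variable {𝕜 : Type*} [RCLike 𝕜] {E : Type*} [NormedAddCommGroup E] [NormedSpace 𝕜 E]

/-- `C₀`-semigroups. -/
structure IsC0Semigroup (U : ℝ≥0 → E →L[𝕜] E) : Prop where
  map_zero : U 0 = ContinuousLinearMap.id 𝕜 E
  map_add : ∀ s t, U (s + t) = (U s).comp (U t)
  continuous : ∀ v, Continuous fun s => U s v

/-- The graph of the infinitesimal generator of `U`. -/
def generatorGraph (U : ℝ≥0 → E →L[𝕜] E) : Set (E × E) :=
  {p | Tendsto (fun h : ℝ≥0 => (((h : ℝ) : 𝕜)⁻¹) • (U h p.1 - p.1)) (𝓝[>] 0) (𝓝 p.2)}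

/-- The range of `c - T`, where `𝒯` is the graph of `T`. -/
def rangeSub (𝕜 : Type*) [RCLike 𝕜] [NormedSpace 𝕜 E] (c : ℝ) (𝒯 : Set (E × E)) : Set E :=
  (fun p : E × E => (c : 𝕜) • p.1 - p.2) '' 𝒯

/-- The space of continuous linear operators on `E`, with the
topology of uniform convergence on the members of `𝔖`. -/
abbrev LS (𝕜 : Type*) [RCLike 𝕜] [NormedSpace 𝕜 E] (𝔖 : Set (Set E)) : Type _ :=
  UniformConvergenceCLM (RingHom.id 𝕜) (E := E) E 𝔖

/-- An operator, viewed as a point of `LS 𝕜 𝔖`. -/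
def toLS (𝔖 : Set (Set E)) (A : E →L[𝕜] E) : LS 𝕜 𝔖 :=
  UniformConvergenceCLM.ofFun (RingHom.id 𝕜) E 𝔖 A

/-- The two parallel cases of the theorem. -/
inductive SemigroupKind
  | contraction
  | isometry

/-- All the operators `U s` are contractions, respectively isometries. -/
def SemigroupKind.Holds (κ : SemigroupKind) (U : ℝ≥0 → E →L[𝕜] E) : Prop :=
  match κ with
  | .contraction => ∀ s, ‖U s‖ ≤ 1
  | .isometry => ∀ s v, ‖U s v‖ = ‖v‖

/-- The density conditions on the range of `λ₀ - T` (respectively, of `λ₀ - T` and `λ₁ - T`). -/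
def SemigroupKind.RangeCond (κ : SemigroupKind) (𝕜 : Type*) [RCLike 𝕜] [NormedSpace 𝕜 E]
    (𝒯 : Set (E × E)) : Prop :=
  match κ with
  | .contraction => ∃ c₀ : ℝ, 0 < c₀ ∧ Dense (rangeSub 𝕜 c₀ 𝒯)
  | .isometry => ∃ c₀ c₁ : ℝ, 0 < c₀ ∧ c₁ < 0 ∧
      Dense (rangeSub 𝕜 c₀ 𝒯) ∧ Dense (rangeSub 𝕜 c₁ 𝒯)

/-- `𝐔(ℒ_𝔖(E))`: the one-parameter semigroups that are continuous into `LS 𝕜 𝔖`. -/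
def contSemigroups (𝕜 : Type*) [RCLike 𝕜] [NormedSpace 𝕜 E] (𝔖 : Set (Set E)) :
    Set (ℝ≥0 → E →L[𝕜] E) :=
  {U | U 0 = ContinuousLinearMap.id 𝕜 E ∧ (∀ s t, U (s + t) = (U s).comp (U t)) ∧
    Continuous fun s => toLS 𝔖 (U s)}

/-- The members of `𝐔(ℒ_𝔖(E))` with operator norms at most one, respectively those for which some
family of seminorms that defines the topology of `E` is preserved by all the operators. -/
def SemigroupKind.semigroups (κ : SemigroupKind) (𝕜 : Type*) [RCLike 𝕜] [NormedSpace 𝕜 E]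
    (𝔖 : Set (Set E)) : Set (ℝ≥0 → E →L[𝕜] E) :=
  match κ with
  | .contraction => {U | U ∈ contSemigroups 𝕜 𝔖 ∧ ∀ s, ‖U s‖ ≤ 1}
  | .isometry => {U | U ∈ contSemigroups 𝕜 𝔖 ∧ ∃ G : Set (Seminorm 𝕜 E),
      WithSeminorms (fun p : G => (p : Seminorm 𝕜 E)) ∧ ∀ p ∈ G, ∀ s v, p (U s v) = p v}

/-- `A` is the integral over `[0, ∞)` of `e^{-cs} f(s)`, in the weak sense with
respect to the continuous linear functionals on `LS 𝕜 𝔖`. -/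
def HasLaplace (𝔖 : Set (Set E)) (f : ℝ≥0 → E →L[𝕜] E) (c : ℝ) (A : E →L[𝕜] E) : Prop :=
  ∀ ψ : LS 𝕜 𝔖 →L[𝕜] 𝕜,
    IntegrableOn (fun s : ℝ => (Real.exp (-(c * s)) : 𝕜) * ψ (toLS 𝔖 (f s.toNNReal))) (Ioi 0) ∧
    ∫ s in Ioi (0 : ℝ), (Real.exp (-(c * s)) : 𝕜) * ψ (toLS 𝔖 (f s.toNNReal)) = ψ (toLS 𝔖 A)

open Classical in
/-- The Laplace transform of `f` at `c`. -/
noncomputable def laplace (𝔖 : Set (Set E)) (f : ℝ≥0 → E →L[𝕜] E) (c : ℝ) : E →L[𝕜] E :=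
  if h : ∃ A, HasLaplace 𝔖 f c A then h.choose else 0

end Semigroups

/-! ### `(Θ, ℰ)`-structures over a Banach bundle, with parameter space `[0, ∞)` -/

section Structures

variable {X : Type*} [TopologicalSpace X] {E : X → Type*} [∀ x, NormedAddCommGroup (E x)]

/-- `𝐃(B, ℰ)`: the members of `ℰ` with values in `B`. -/
def selIn (ℰ : Set (∀ x, E x)) (B : ∀ x, Set (E x)) : Set (∀ x, E x) :=
  {v | v ∈ ℰ ∧ ∀ x, v x ∈ B x}

/-- `ℬ_B^x`: the values at `x` of the members of `𝐃(B, ℰ)`. -/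
def valuesIn (ℰ : Set (∀ x, E x)) (B : ∀ x, Set (E x)) (x : X) : Set (E x) :=
  {w | ∃ v ∈ selIn ℰ B, v x = w}

/-- `S_x = {ℬ_B^x | B ∈ Θ}`. -/
def boundedFamily (ℰ : Set (∀ x, E x)) (Θ : Set (∀ x, Set (E x))) (x : X) : Set (Set (E x)) :=
  {b | ∃ B ∈ Θ, b = valuesIn ℰ B x}

variable {𝕜 : Type*} [RCLike 𝕜] [∀ x, NormedSpace 𝕜 (E x)]

/-- The bundle whose stalk at `x` is the space `M x` of maps from `[0, ∞)` to operators on `E x`.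
Its seminorms are indexed by the finite sets of pairs of a compact `K` and a `B ∈ Θ`:
the supremum over these pairs, over `t ∈ K` and over `v ∈ 𝐃(B, ℰ)`, of `‖f t (v x)‖`. -/
noncomputable def mapBundle (ℰ : Set (∀ x, E x)) (Θ : Set (∀ x, Set (E x)))
    (M : ∀ x, Submodule 𝕜 (ℝ≥0 → E x →L[𝕜] E x)) (γ : TopologicalSpace (Tot fun x => M x)) :
    Prebundle (fun x => M x) (Finset (TopologicalSpace.Compacts ℝ≥0 × Θ)) where
  sn := fun O x f => sSup {r | ∃ o ∈ O, ∃ t ∈ o.1, ∃ v ∈ selIn ℰ (o.2 : ∀ x, Set (E x)),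
    r = ‖(f : ℝ≥0 → E x →L[𝕜] E x) t (v x)‖}
  top := γ

/-- `(Θ, ℰ)`-structures. -/
structure IsThetaStructure (τ : TopologicalSpace (Tot E)) (ℰ : Set (∀ x, E x))
    (Θ : Set (∀ x, Set (E x))) (M : ∀ x, Submodule 𝕜 (ℝ≥0 → E x →L[𝕜] E x))
    (γ : TopologicalSpace (Tot fun x => M x)) : Prop where
  isOmegaBundle_base : (normed τ).IsOmegaBundle 𝕜
  subset_sections : ℰ ⊆ (normed τ).Gamma
  nonempty : Θ.Nonempty
  bounded : ∀ B ∈ Θ, ∀ x, Bornology.IsBounded (B x)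
  selIn_nonempty : ∀ B ∈ Θ, (selIn ℰ B).Nonempty
  total : ∀ x, Dense (Submodule.span 𝕜 (⋃₀ boundedFamily ℰ Θ x) : Set (E x))
  continuous_mem : ∀ x, ∀ f ∈ M x, Continuous fun t => toLS (boundedFamily ℰ Θ x) (f t)
  isOmegaBundle_maps : (mapBundle ℰ Θ M γ).IsOmegaBundle 𝕜

/-- The Laplace duality property `LD_x(𝒪, 𝒟)`. -/
def LDAt (τ : TopologicalSpace (Tot E)) (ℰ : Set (∀ x, E x))
    (Θ : Set (∀ x, Set (E x))) (M : ∀ x, Submodule 𝕜 (ℝ≥0 → E x →L[𝕜] E x))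
    (γ : TopologicalSpace (Tot fun x => M x)) (x : X)
    (𝒪 : Set (∀ x, M x)) (𝒟 : Set (∀ x, E x)) : Prop :=
  ∀ c : ℝ, 0 < c →
    ∀ G ∈ (mapBundle ℰ Θ M γ).GammaAt x, (∃ F ∈ 𝒪, G x = F x) →
    ∀ w ∈ (normed τ).GammaAt x, (∃ v ∈ 𝒟, w x = v x) →
      (fun z => laplace (boundedFamily ℰ Θ z) (G z : ℝ≥0 → E z →L[𝕜] E z) c (w z)) ∈
        (normed τ).GammaAt x

/-- The full Laplace duality property `LD(𝒪, 𝒟)`. -/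
def LDFull (τ : TopologicalSpace (Tot E)) (ℰ : Set (∀ x, E x))
    (Θ : Set (∀ x, Set (E x))) (M : ∀ x, Submodule 𝕜 (ℝ≥0 → E x →L[𝕜] E x))
    (𝒪 : Set (∀ x, M x)) (𝒟 : Set (∀ x, E x)) : Prop :=
  ∀ c : ℝ, 0 < c → ∀ G ∈ 𝒪, ∀ w ∈ 𝒟,
    (fun z => laplace (boundedFamily ℰ Θ z) (G z : ℝ≥0 → E z →L[𝕜] E z) c (w z)) ∈
      (normed τ).Gamma

/-- The class `Δ_Θ⟨𝔙, 𝔚⟩(ℰ, X, ℝ⁺)` of sets of triples `⟨𝒯, x∞, Φ⟩`. -/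
def DeltaClass (τ : TopologicalSpace (Tot E)) (ℰ : Set (∀ x, E x))
    (Θ : Set (∀ x, Set (E x))) (M : ∀ x, Submodule 𝕜 (ℝ≥0 → E x →L[𝕜] E x))
    (γ : TopologicalSpace (Tot fun x => M x)) :
    Set (Set ((∀ x, Set (E x × E x)) × X × Set (∀ x, E x × E x))) :=
  {Ω | ∀ p ∈ Ω, IsGraphSection 𝕜 τ p.1 p.2.1 p.2.2 ∧
    ∃ V ∈ (mapBundle ℰ Θ M γ).GammaAt p.2.1, ∀ x,
      IsC0Semigroup (V x : ℝ≥0 → E x →L[𝕜] E x) ∧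
      (∃ C : ℝ, ∀ s, ‖(V x : ℝ≥0 → E x →L[𝕜] E x) s‖ ≤ C) ∧
      p.1 x = generatorGraph (V x : ℝ≥0 → E x →L[𝕜] E x)}

/-- The sequence of functions `f (z n)` is bounded and equicontinuous. -/
def IsBoundedEquicontinuous (f : ∀ x, ℝ≥0 → E x) (z : ℕ → X) : Prop :=
  (∃ C : ℝ, ∀ n s, ‖f (z n) s‖ ≤ C) ∧
  ∀ s₀ : ℝ≥0, ∀ ε : ℝ, 0 < ε → ∃ U ∈ 𝓝 s₀, ∀ s ∈ U, ∀ n, ‖f (z n) s - f (z n) s₀‖ ≤ ε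

end Structures

/-! ### The objects attached to a family of semigroups outside a point -/

section Limit

variable {X : Type*} [TopologicalSpace X] {E : X → Type*} [∀ x, NormedAddCommGroup (E x)]
  {𝕜 : Type*} [RCLike 𝕜] [∀ x, NormedSpace 𝕜 (E x)]

/-- `Φ`: the selections of `𝔙 ⊕ 𝔙` that are bounded, continuous at `x∞`, and
for `x ≠ x∞` take values in the graph of the generator of `U₀ x`. -/
def limitPhi (τ : TopologicalSpace (Tot E)) (xinf : X) (U₀ : ∀ x, ℝ≥0 → E x →L[𝕜] E x) :
    Set (∀ x, E x × E x) :=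
  {φ | φ ∈ ((normed τ).directSum 𝕜 (normed τ)).GammaAt xinf ∧
    ∀ x, x ≠ xinf → φ x ∈ generatorGraph (U₀ x)}

/-- `𝒯`: the graph of the generator of `U₀ x` for `x ≠ x∞`, and
the set of the values at `x∞` of the members of `Φ` for `x = x∞`. -/
def limitGraph (τ : TopologicalSpace (Tot E)) (xinf : X) (U₀ : ∀ x, ℝ≥0 → E x →L[𝕜] E x)
    (x : X) : Set (E x × E x) :=
  {p | (x ≠ xinf ∧ p ∈ generatorGraph (U₀ x)) ∨
    (x = xinf ∧ ∃ φ ∈ limitPhi τ xinf U₀, φ x = p)}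

/-- `ℰ`: the bounded continuous selections of `𝔙` whose value at `x∞` is in the domain of the
limit operator. -/
def limitE (τ : TopologicalSpace (Tot E)) (xinf : X) (U₀ : ∀ x, ℝ≥0 → E x →L[𝕜] E x) :
    Set (∀ x, E x) :=
  {v | v ∈ (normed τ).Gamma ∧ ∃ φ ∈ limitPhi τ xinf U₀, v xinf = (φ xinf).1}

/-- `Θ`: the families of singletons `x ↦ {w x}`, for `w ∈ ℰ`. -/
def limitTheta (τ : TopologicalSpace (Tot E)) (xinf : X) (U₀ : ∀ x, ℝ≥0 → E x →L[𝕜] E x) :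
    Set (∀ x, Set (E x)) :=
  {B | ∃ w ∈ limitE τ xinf U₀, B = fun x => {w x}}

end Limit

end OmegaBundle

open OmegaBundle

/-! Part (1). The graph of the limit operator is a linear relation consisting of values at `x∞` of
selections along which the norm is continuous. The dissipativity inequality of the generators at `x
≠ x∞` therefore passes to the limit, since `x∞` is not isolated. A dissipative relation with dense
domain is single-valued, so the limit is an operator.

The relation is also closed (`isClosed_limitOperator`). Given a limit of values `φ_n(x∞)`, the
differences of consecutive selections are truncated to zero wherever they are large. Membership in
`Φ` constrains a selection only by boundedness, by continuity at `x∞` and by lying in the fibrewise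
graphs, which contain `0`, so truncation is harmless. The series then converges uniformly, and its
sum stays in `Φ` because each generator graph is closed. For a closed dissipative relation a dense
range of `λ₀ - T` is the whole space, and the Lumer-Phillips theorem
`IsDissipative.exists_semigroup`, proved by Yosida approximation, yields a contraction semigroup.
For isometries the inequality `‖v‖ ≤ ‖v + h T v‖` also survives the limit and prevents orbits from
losing norm.

Part (2). The Laplace transform of a contraction semigroup is the resolvent of its generator. As `λ
- T` is onto at `x∞`, every vector there is `λ ψ₁(x∞) - ψ₂(x∞)` with `ψ ∈ Φ`. The Laplace transform
of the orbit of `λ ψ₁(z) - ψ₂(z)` is `ψ₁(z)`, which is continuous at `x∞`; so the transforms of the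
semigroups are continuous there (`tendsto_laplace_orbit`). Those of `F` are continuous by
hypothesis, with the same value at `x∞`. Along a sequence `z_n → x∞`, the functions `U(z_n) φ₁(z_n)
- F(z_n) v(z_n)` are bounded and equicontinuous with vanishing Laplace transforms. By Weierstrass
approximation in the variable `e^{-s}` they tend to zero pointwise (`tendsto_of_tendsto_laplace`),
hence uniformly on compact sets. Metrizability makes sequences sufficient. Continuity of `U` at `x∞`
is then inherited from `F`. -/

namespace OmegaBundle

/-! ### Semigroups and their generators -/

section SemigroupTheory

variable {𝕜 : Type*} [RCLike 𝕜] {E : Type*} [NormedAddCommGroup E] [NormedSpace 𝕜 E]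

/-- The orbit of `v`, extended to the real line by its value at `0`. -/
def orbit (U : ℝ≥0 → E →L[𝕜] E) (v : E) (s : ℝ) : E := U s.toNNReal v

theorem IsC0Semigroup.continuous_orbit {U : ℝ≥0 → E →L[𝕜] E} (hU : IsC0Semigroup U) (v : E) :
    Continuous (orbit U v) :=
  (hU.continuous v).comp continuous_real_toNNReal

theorem IsC0Semigroup.orbit_zero {U : ℝ≥0 → E →L[𝕜] E} (hU : IsC0Semigroup U) (v : E) :
    orbit U v 0 = v := by
  simp [orbit, hU.map_zero]

theorem IsC0Semigroup.orbit_add {U : ℝ≥0 → E →L[𝕜] E} (hU : IsC0Semigroup U) (v : E) {s t : ℝ}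
    (hs : 0 ≤ s) (ht : 0 ≤ t) : orbit U v (s + t) = U s.toNNReal (orbit U v t) := by
  simp [orbit, Real.toNNReal_add hs ht, hU.map_add]

theorem norm_apply_le_of_norm_le_one {A : E →L[𝕜] E} (hA : ‖A‖ ≤ 1) (v : E) : ‖A v‖ ≤ ‖v‖ := by
  simpa using A.le_of_opNorm_le hA v

theorem SemigroupKind.Holds.norm_le_one {κ : SemigroupKind} {U : ℝ≥0 → E →L[𝕜] E}
    (h : κ.Holds U) (s : ℝ≥0) : ‖U s‖ ≤ 1 := by
  cases κ with
  | contraction => exact h s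
  | isometry =>
    refine ContinuousLinearMap.opNorm_le_bound _ zero_le_one fun v => ?_
    rw [one_mul]
    exact (h s v).le

theorem generatorGraph_smul_mem {U : ℝ≥0 → E →L[𝕜] E} {p : E × E} (c : 𝕜)
    (hp : p ∈ generatorGraph U) : c • p ∈ generatorGraph U := by
  refine (hp.const_smul c).congr fun h => ?_
  rw [Prod.smul_fst, map_smul, ← smul_sub, smul_comm]

theorem generatorGraph_unique {U : ℝ≥0 → E →L[𝕜] E} {v w w' : E} (hp : (v, w) ∈ generatorGraph U)
    (hq : (v, w') ∈ generatorGraph U) : w = w' := by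
  exact tendsto_nhds_unique hp hq

theorem generatorGraph_map_mem {U : ℝ≥0 → E →L[𝕜] E} (hU : IsC0Semigroup U) {p : E × E}
    (hp : p ∈ generatorGraph U) (t : ℝ≥0) : (U t p.1, U t p.2) ∈ generatorGraph U := by
  refine (((U t).continuous.tendsto p.2).comp hp).congr fun h => ?_
  simp only [Function.comp, map_smul, map_sub]
  rw [← ContinuousLinearMap.comp_apply, ← hU.map_add, add_comm, hU.map_add]
  rfl

theorem continuous_apply_apply {S : ℝ≥0 → E →L[𝕜] E} (hS : IsC0Semigroup S)
    (hc : ∀ s, ‖S s‖ ≤ 1) : Continuous fun q : ℝ≥0 × E => S q.1 q.2 := by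
  rw [continuous_iff_continuousAt]
  rintro ⟨t, v⟩
  have h1 : Tendsto (fun q : ℝ≥0 × E => S q.1 (q.2 - v)) (𝓝 (t, v)) (𝓝 0) := by
    refine squeeze_zero_norm (fun q => norm_apply_le_of_norm_le_one (hc _) _) ?_
    have : Tendsto (fun q : ℝ≥0 × E => ‖q.2 - v‖) (𝓝 (t, v)) (𝓝 ‖v - v‖) :=
      ((continuous_snd.sub continuous_const).norm).tendsto _
    simpa using this
  have h2 : Tendsto (fun q : ℝ≥0 × E => S q.1 v) (𝓝 (t, v)) (𝓝 (S t v)) :=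
    ((hS.continuous v).comp continuous_fst).tendsto (t, v)
  have := h1.add h2
  rw [zero_add] at this
  refine this.congr fun q => ?_
  simp

theorem norm_orbit_le {U : ℝ≥0 → E →L[𝕜] E} (hc : ∀ s, ‖U s‖ ≤ 1) (v : E) (s : ℝ) :
    ‖orbit U v s‖ ≤ ‖v‖ := norm_apply_le_of_norm_le_one (hc _) v

/-- Convexity of `t ↦ ‖p - t • q‖`: the point `p - t • q` is a convex combination of `p` and `p - h
• q`. -/
theorem norm_le_norm_sub_smul_of_small {E : Type*} [NormedAddCommGroup E] [NormedSpace ℝ E] {p q : E}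
    {t h : ℝ} (ht : 0 < t) (hth : t ≤ h) (H : ‖p‖ ≤ ‖p - t • q‖) : ‖p‖ ≤ ‖p - h • q‖ := by
  have hh : 0 < h := ht.trans_le hth
  have e : p - t • q = (1 - t / h) • p + (t / h) • (p - h • q) := by
    rw [smul_sub, smul_smul, div_mul_cancel₀ _ hh.ne', sub_smul, one_smul]
    abel
  have h1 : t / h ≤ 1 := (div_le_one hh).2 hth
  have h0 : 0 < t / h := div_pos ht hh
  have h2 : ‖p‖ ≤ (1 - t / h) * ‖p‖ + t / h * ‖p - h • q‖ := by
    refine H.trans ?_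
    rw [e]
    refine (norm_add_le _ _).trans ?_
    rw [norm_smul, norm_smul, Real.norm_of_nonneg (sub_nonneg.2 h1), Real.norm_of_nonneg h0.le]
  have h3 : t / h * ‖p‖ ≤ t / h * ‖p - h • q‖ := by linarith
  exact le_of_mul_le_mul_left h3 h0

theorem integrableOn_exp_smul_of_bounded {E : Type*} [NormedAddCommGroup E] [NormedSpace ℝ E]
    {f : ℝ → E} (hf : Continuous f) {C : ℝ}
    (hC : ∀ s, 0 < s → ‖f s‖ ≤ C) {c : ℝ} (hc : 0 < c) :
    IntegrableOn (fun s => Real.exp (-(c * s)) • f s) (Ioi 0) := by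
  have h1 : IntegrableOn (fun s : ℝ => Real.exp (-(c * s)) * C) (Ioi 0) := by
    have : IntegrableOn (fun s : ℝ => Real.exp (-c * s) * C) (Ioi 0) :=
      (exp_neg_integrableOn_Ioi 0 hc).mul_const C
    simpa only [neg_mul] using this
  refine Integrable.mono' h1 ?_ (ae_restrict_of_forall_mem measurableSet_Ioi fun s hs => ?_)
  · exact Continuous.aestronglyMeasurable (by fun_prop)
  · rw [norm_smul, Real.norm_of_nonneg (Real.exp_pos _).le]
    exact mul_le_mul_of_nonneg_left (hC s hs) (Real.exp_pos _).le

theorem norm_integral_exp_smul_le {E : Type*} [NormedAddCommGroup E] [NormedSpace ℝ E] {f : ℝ → E} {C : ℝ}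
    (hC : ∀ s, 0 < s → ‖f s‖ ≤ C) {c : ℝ} (hc : 0 < c) :
    ‖∫ s in Ioi (0 : ℝ), Real.exp (-(c * s)) • f s‖ ≤ C / c := by
  have h1 : IntegrableOn (fun s : ℝ => Real.exp (-(c * s)) * C) (Ioi 0) := by
    have : IntegrableOn (fun s : ℝ => Real.exp (-c * s) * C) (Ioi 0) :=
      (exp_neg_integrableOn_Ioi 0 hc).mul_const C
    simpa only [neg_mul] using this
  have h2 : ∫ s in Ioi (0 : ℝ), Real.exp (-(c * s)) * C = C / c := by
    rw [integral_mul_const]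
    have := integral_exp_mul_Ioi (neg_lt_zero.2 hc) 0
    simp only [neg_mul] at this
    rw [this]
    simp
    field_simp
  rw [← h2]
  refine norm_integral_le_of_norm_le h1 (ae_restrict_of_forall_mem measurableSet_Ioi fun s hs => ?_)
  rw [norm_smul, Real.norm_of_nonneg (Real.exp_pos _).le]
  exact mul_le_mul_of_nonneg_left (hC s hs) (Real.exp_pos _).le

variable [NormedSpace ℝ E] [IsScalarTower ℝ 𝕜 E]

/-- Restating the limit with a real variable and real scalars makes calculus on `ℝ` available for
orbits. -/
theorem mem_generatorGraph {U : ℝ≥0 → E →L[𝕜] E} {p : E × E} :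
    p ∈ generatorGraph U ↔
      Tendsto (fun h : ℝ => h⁻¹ • (orbit U p.1 h - p.1)) (𝓝[>] 0) (𝓝 p.2) := by
  have key : ∀ (h : ℝ≥0), (((h : ℝ) : 𝕜)⁻¹) • (U h p.1 - p.1) =
      (h : ℝ)⁻¹ • (orbit U p.1 h - p.1) := fun h => by
    rw [RCLike.real_smul_eq_coe_smul (K := 𝕜)]
    simp [orbit]
  have e1 : map ((↑) : ℝ≥0 → ℝ) (𝓝[>] 0) = 𝓝[>] 0 := by
    rw [NNReal.isEmbedding_coe.map_nhdsWithin_eq, NNReal.coe_zero]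
    congr 1
    ext x
    exact ⟨fun ⟨y, hy, e⟩ => e ▸ NNReal.coe_pos.2 hy,
      fun hx => ⟨⟨x, le_of_lt hx⟩, NNReal.coe_pos.1 hx, rfl⟩⟩
  rw [← e1, tendsto_map'_iff]
  unfold generatorGraph
  simp only [mem_ofPred_eq, key]
  rfl

/-- The difference quotient at `t` is `U t` applied to the one at `0`. A right derivative is all
that the later uses of calculus require. -/
theorem hasDerivWithinAt_orbit {U : ℝ≥0 → E →L[𝕜] E} (hU : IsC0Semigroup U) {p : E × E}
    (hp : p ∈ generatorGraph U) {t : ℝ} (ht : 0 ≤ t) :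
    HasDerivWithinAt (orbit U p.1) (orbit U p.2 t) (Ici t) t := by
  rw [← hasDerivWithinAt_Ioi_iff_Ici, hasDerivWithinAt_iff_tendsto_slope' self_notMem_Ioi]
  have h1 : Tendsto (fun y => y - t) (𝓝[>] t) (𝓝[>] 0) := by
    refine tendsto_nhdsWithin_iff.2 ⟨?_, ?_⟩
    · have : Tendsto (fun y => y - t) (𝓝 t) (𝓝 (t - t)) := tendsto_id.sub_const t
      rw [sub_self] at this
      exact this.mono_left nhdsWithin_le_nhds
    · filter_upwards [self_mem_nhdsWithin] with y hy
      exact sub_pos.2 (mem_Ioi.1 hy)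
  have h2 := ((U t.toNNReal).continuous.tendsto p.2).comp ((mem_generatorGraph.1 hp).comp h1)
  refine h2.congr' ?_
  filter_upwards [self_mem_nhdsWithin] with y hy
  have hy' : 0 ≤ y - t := (sub_pos.2 (mem_Ioi.1 hy)).le
  have e := hU.orbit_add p.1 ht hy'
  rw [add_sub_cancel] at e
  simp only [Function.comp, slope_def_module, e]
  rw [ContinuousLinearMap.map_smul_of_tower, map_sub]
  rfl

theorem integral_orbit_of_mem [CompleteSpace E] {U : ℝ≥0 → E →L[𝕜] E} (hU : IsC0Semigroup U)
    {p : E × E} (hp : p ∈ generatorGraph U) {t : ℝ} (ht : 0 ≤ t) :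
    ∫ s in (0 : ℝ)..t, orbit U p.2 s = orbit U p.1 t - p.1 := by
  rw [intervalIntegral.integral_eq_sub_of_hasDeriv_right_of_le ht
    (hU.continuous_orbit p.1).continuousOn
    (fun x hx => (hasDerivWithinAt_orbit hU hp hx.1.le).mono Ioi_subset_Ici_self)
    ((hU.continuous_orbit p.2).intervalIntegrable _ _), hU.orbit_zero]

/-- Converse of `integral_orbit_of_mem`. Together they describe the generator by integral
identities, which, unlike difference quotients, are stable under limits. -/
theorem mem_generatorGraph_of_integral [CompleteSpace E] {U : ℝ≥0 → E →L[𝕜] E}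
    (hU : IsC0Semigroup U) {p : E × E}
    (h : ∀ t : ℝ, 0 ≤ t → ∫ s in (0 : ℝ)..t, orbit U p.2 s = orbit U p.1 t - p.1) :
    p ∈ generatorGraph U := by
  rw [mem_generatorGraph]
  have h1 := ((hU.continuous_orbit p.2).integral_hasStrictDerivAt 0 0).hasDerivAt.hasDerivWithinAt
    (s := Ioi 0)
  rw [hasDerivWithinAt_iff_tendsto_slope' self_notMem_Ioi, hU.orbit_zero] at h1
  refine h1.congr' ?_
  filter_upwards [self_mem_nhdsWithin] with y hy
  simp [slope_def_module, h y (le_of_lt hy)]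

theorem isClosed_generatorGraph [CompleteSpace E] {U : ℝ≥0 → E →L[𝕜] E} (hU : IsC0Semigroup U)
    (hc : ∀ s, ‖U s‖ ≤ 1) : IsClosed (generatorGraph U) := by
  have e : generatorGraph U = ⋂ t : ℝ≥0, {p : E × E |
      ∫ s in (0 : ℝ)..t, orbit U p.2 s = orbit U p.1 t - p.1} := by
    ext p
    simp only [mem_iInter, mem_ofPred_eq]
    exact ⟨fun hp t => integral_orbit_of_mem hU hp t.2,
      fun h => mem_generatorGraph_of_integral hU fun t ht => h ⟨t, ht⟩⟩
  rw [e]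
  refine isClosed_iInter fun t => isClosed_eq ?_ ?_
  · have : Continuous fun y : E => ∫ s in (0 : ℝ)..t, orbit U y s := by
      refine (LipschitzWith.of_dist_le_mul (K := t) fun x y => ?_).continuous
      rw [dist_eq_norm, dist_eq_norm, ← intervalIntegral.integral_sub
        ((hU.continuous_orbit x).intervalIntegrable _ _)
        ((hU.continuous_orbit y).intervalIntegrable _ _)]
      have := intervalIntegral.norm_integral_le_of_norm_le_const (a := 0) (b := (t : ℝ))
        (f := fun s => orbit U x s - orbit U y s) (C := ‖x - y‖) fun s _ => by
          rw [orbit, orbit, ← map_sub]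
          exact norm_apply_le_of_norm_le_one (hc _) _
      rwa [sub_zero, NNReal.abs_eq, mul_comm] at this
    exact this.comp continuous_snd
  · exact (((U _).continuous).comp continuous_fst).sub continuous_fst

theorem generatorGraph_zero_mem (U : ℝ≥0 → E →L[𝕜] E) : (0 : E × E) ∈ generatorGraph U := by
  simp [mem_generatorGraph, orbit]

theorem generatorGraph_add_mem {U : ℝ≥0 → E →L[𝕜] E} {p q : E × E} (hp : p ∈ generatorGraph U)
    (hq : q ∈ generatorGraph U) : p + q ∈ generatorGraph U := by
  rw [mem_generatorGraph] at *
  refine (hp.add hq).congr fun h => ?_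
  simp only [orbit, Prod.fst_add, map_add, ← smul_add]
  congr 1
  abel

/-- With `q_t` the difference quotient, `p - t q_t = 2p - U_t p` has norm at least `‖p‖`. Convexity
replaces `t` by `h`, and then `t → 0`. -/
theorem norm_le_norm_sub_smul {U : ℝ≥0 → E →L[𝕜] E}
    (hc : ∀ s, ‖U s‖ ≤ 1) {p : E × E} (hp : p ∈ generatorGraph U) {h : ℝ} (hh : 0 < h) :
    ‖p.1‖ ≤ ‖p.1 - h • p.2‖ := by
  have h1 := (tendsto_const_nhds (x := p.1)).sub ((mem_generatorGraph.1 hp).const_smul h)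
  refine ge_of_tendsto h1.norm ?_
  filter_upwards [Ioc_mem_nhdsGT hh] with t ht
  refine norm_le_norm_sub_smul_of_small ht.1 ht.2 ?_
  rw [smul_inv_smul₀ ht.1.ne']
  have h2 : ‖p.1 + p.1‖ = 2 * ‖p.1‖ := by
    rw [← two_smul ℝ, norm_smul]; simp
  have h3 : ‖orbit U p.1 t‖ ≤ ‖p.1‖ := norm_apply_le_of_norm_le_one (hc _) _
  have h4 : p.1 - (orbit U p.1 t - p.1) = (p.1 + p.1) - orbit U p.1 t := by abel
  rw [h4]
  have := norm_sub_norm_le (p.1 + p.1) (orbit U p.1 t)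
  linarith

/-- The same argument with `p + t q_t = U_t p`, whose norm is exactly `‖p‖`. -/
theorem norm_le_norm_add_smul {U : ℝ≥0 → E →L[𝕜] E}
    (hc : ∀ s v, ‖U s v‖ = ‖v‖) {p : E × E} (hp : p ∈ generatorGraph U) {h : ℝ} (hh : 0 < h) :
    ‖p.1‖ ≤ ‖p.1 + h • p.2‖ := by
  have h1 := (tendsto_const_nhds (x := p.1)).add ((mem_generatorGraph.1 hp).const_smul h)
  refine ge_of_tendsto h1.norm ?_
  filter_upwards [Ioc_mem_nhdsGT hh] with t ht
  rw [← sub_neg_eq_add, ← smul_neg]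
  refine norm_le_norm_sub_smul_of_small ht.1 ht.2 ?_
  rw [smul_neg, smul_inv_smul₀ ht.1.ne', sub_neg_eq_add, add_sub_cancel]
  exact (hc _ _).ge

/-- A contraction semigroup whose generator is conservative consists of isometries. -/
theorem norm_apply_eq_of_norm_le_norm_add_smul {U : ℝ≥0 → E →L[𝕜] E} (hU : IsC0Semigroup U)
    (hc : ∀ s, ‖U s‖ ≤ 1) (hd : Dense (Prod.fst '' generatorGraph U))
    (hcons : ∀ p ∈ generatorGraph U, ∀ h : ℝ, 0 < h → ‖p.1‖ ≤ ‖p.1 + h • p.2‖) (s : ℝ≥0) (v : E) :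
    ‖U s v‖ = ‖v‖ := by
  refine le_antisymm (norm_apply_le_of_norm_le_one (hc s) v) ?_
  have hcl : IsClosed {v : E | ‖v‖ ≤ ‖U s v‖} :=
    isClosed_le continuous_norm (U s).continuous.norm
  suffices H : Prod.fst '' generatorGraph U ⊆ {v : E | ‖v‖ ≤ ‖U s v‖} from
    hcl.closure_subset_iff.2 H (hd v)
  rintro _ ⟨p, hp, rfl⟩
  rcases eq_or_ne s 0 with rfl | hs
  · simp [hU.map_zero]
  have hs0 : (0 : ℝ) < s := NNReal.coe_pos.2 (pos_iff_ne_zero.2 hs)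
  -- Orbits through the domain stay in the domain, so conservativity applies at each of the `k` time
  -- steps. Each step loses at most the first-order error of `U h p.1`.
  have step : ∀ (h : ℝ≥0), 0 < h → ∀ k : ℕ, ‖p.1‖ - k * ‖U h p.1 - p.1 - (h : ℝ) • p.2‖ ≤
      ‖U (k * h) p.1‖ := by
    intro h hh k
    induction k with
    | zero => simp [hU.map_zero]
    | succ k ih =>
      have hm := hcons _ (generatorGraph_map_mem hU hp (k * h)) h (NNReal.coe_pos.2 hh)
      have e : U (((k + 1 : ℕ) : ℝ≥0) * h) p.1 =
          (U (k * h) p.1 + (h : ℝ) • U (k * h) p.2) + U (k * h) (U h p.1 - p.1 - (h : ℝ) • p.2) := by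
        rw [Nat.cast_succ, add_mul, one_mul, hU.map_add, map_sub, map_sub, ContinuousLinearMap.map_smul_of_tower]
        simp
      have h1 := norm_apply_le_of_norm_le_one (hc (k * h)) (U h p.1 - p.1 - (h : ℝ) • p.2)
      have h2 : ‖U (k * h) p.1 + (h : ℝ) • U (k * h) p.2‖ -
          ‖U (k * h) (U h p.1 - p.1 - (h : ℝ) • p.2)‖ ≤ ‖U (((k + 1 : ℕ) : ℝ≥0) * h) p.1‖ := by
        rw [e]
        exact norm_sub_le_norm_add _ _
      push_cast at h2 ⊢
      linarith
  -- With `n + 1` steps of length `s / (n + 1)` the total loss is `s` times the error of the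
  -- difference quotient, which vanishes.
  have hlim : Tendsto (fun n : ℕ => ‖p.1‖ - (s : ℝ) *
      ‖((s : ℝ) / (n + 1 : ℝ))⁻¹ • (orbit U p.1 (s / (n + 1)) - p.1) - p.2‖) atTop
      (𝓝 (‖p.1‖ - s * ‖p.2 - p.2‖)) := by
    have h0 : Tendsto (fun n : ℕ => (s : ℝ) / (n + 1 : ℝ)) atTop (𝓝[>] 0) := by
      refine tendsto_nhdsWithin_iff.2 ⟨?_, Eventually.of_forall fun n => ?_⟩
      · have := (tendsto_one_div_add_atTop_nhds_zero_nat (𝕜 := ℝ)).const_mul (s : ℝ)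
        simpa [div_eq_mul_inv] using this
      · exact div_pos hs0 (by positivity)
    exact (((((mem_generatorGraph.1 hp).comp h0).sub_const p.2).norm.const_mul _).const_sub _)
  rw [sub_self, norm_zero, mul_zero, sub_zero] at hlim
  refine le_of_tendsto hlim (Eventually.of_forall fun n => ?_)
  have hh : (0 : ℝ≥0) < s / (n + 1) := by
    apply div_pos (pos_iff_ne_zero.2 hs); positivity
  have h1 := step (s / (n + 1)) hh (n + 1)
  have e1 : ((n + 1 : ℕ) : ℝ≥0) * (s / (n + 1)) = s := by
    push_cast
    field_simp
  rw [e1] at h1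
  refine le_trans (le_of_eq ?_) h1
  have e2 : orbit U p.1 ((s : ℝ) / (n + 1)) = U (s / (n + 1)) p.1 := by
    unfold orbit
    congr 2
    ext
    rw [Real.coe_toNNReal _ (by positivity)]
    simp
  have hr : (0 : ℝ) < (s : ℝ) / (n + 1) := div_pos hs0 (by positivity)
  have e3 : U (s / (n + 1)) p.1 - p.1 - ((s / (n + 1) : ℝ≥0) : ℝ) • p.2 =
      ((s : ℝ) / (n + 1)) • (((s : ℝ) / (n + 1 : ℝ))⁻¹ • (U (s / (n + 1)) p.1 - p.1) - p.2) := by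
    rw [smul_sub, smul_inv_smul₀ hr.ne']
    simp
  rw [e2, e3, norm_smul, Real.norm_of_nonneg hr.le, ← mul_assoc]
  congr 2
  push_cast
  field_simp

/-- A semigroup is determined by its generator. -/
theorem eq_of_generatorGraph_subset {U S : ℝ≥0 → E →L[𝕜] E} (hU : IsC0Semigroup U)
    (hS : IsC0Semigroup S) (hc : ∀ s, ‖S s‖ ≤ 1) (hd : Dense (Prod.fst '' generatorGraph U))
    (hsub : generatorGraph U ⊆ generatorGraph S) : U = S := by
  funext t
  refine ContinuousLinearMap.ext fun v => ?_
  have hcl : IsClosed {v : E | U t v = S t v} := isClosed_eq (U t).continuous (S t).continuous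
  suffices H : Prod.fst '' generatorGraph U ⊆ {v : E | U t v = S t v} from
    hcl.closure_subset_iff.2 H (hd v)
  rintro _ ⟨p, hp, rfl⟩
  -- The path `s ↦ S(t - s) U(s) p` joins `S(t) p` to `U(t) p`; it is constant because its right
  -- derivative vanishes.
  set g : ℝ → E := fun s => S ((t : ℝ) - s).toNNReal (orbit U p.1 s) with hg
  have hcont : Continuous g := (continuous_apply_apply hS hc).comp
    ((continuous_real_toNNReal.comp (continuous_const.sub continuous_id)).prodMk
      (hU.continuous_orbit p.1))
  have hder : ∀ x ∈ Ico (0 : ℝ) t, HasDerivWithinAt g 0 (Ici x) x := by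
    intro x hx
    have hm := generatorGraph_map_mem hU hp x.toNNReal
    have d1 := hasDerivWithinAt_orbit hU hp hx.1
    have d2 : HasDerivWithinAt (fun y => orbit S (orbit U p.1 x) (y - x)) (orbit U p.2 x)
        (Ici x) x := by
      have h0 : HasDerivWithinAt (orbit S (orbit U p.1 x)) (orbit U p.2 x) (Ici (x - x)) (x - x) := by
        have := hasDerivWithinAt_orbit hS (hsub hm) le_rfl
        rw [hS.orbit_zero] at this
        rw [sub_self]
        exact this
      have h1 : HasDerivWithinAt (fun y => y - x) 1 (Ici x) x :=
        (hasDerivAt_id x).sub_const x |>.hasDerivWithinAt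
      have := HasDerivWithinAt.scomp (h := fun y => y - x) x h0 h1 (fun y hy => by
        rw [sub_self]; exact sub_nonneg.2 (mem_Ici.1 hy))
      rwa [one_smul] at this
    have d3 := d1.sub d2
    rw [sub_self] at d3
    rw [← hasDerivWithinAt_Ioi_iff_Ici, hasDerivWithinAt_iff_tendsto_slope' self_notMem_Ioi]
      at d3 ⊢
    refine squeeze_zero_norm' ?_ (tendsto_zero_iff_norm_tendsto_zero.1 d3)
    filter_upwards [Ioo_mem_nhdsGT hx.2] with y hy
    have hxy : 0 ≤ y - x := sub_nonneg.2 hy.1.le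
    have hyt : 0 ≤ (t : ℝ) - y := sub_nonneg.2 hy.2.le
    rw [slope_def_module, slope_def_module, norm_smul, norm_smul]
    refine mul_le_mul_of_nonneg_left ?_ (norm_nonneg _)
    -- Both `g x` and `g y` are images under `S(t - y)`, a contraction. The slope of `g` is thus
    -- dominated by that of the difference of two orbits tangent to each other at `x`.
    have e1 : g x = S ((t : ℝ) - y).toNNReal (orbit S (orbit U p.1 x) (y - x)) := by
      rw [← hS.orbit_add _ hyt hxy, hg, sub_add_sub_cancel]
      rfl
    have e2 : orbit S (orbit U p.1 x) (x - x) = orbit U p.1 x := by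
      rw [sub_self, hS.orbit_zero]
    simp only [Pi.sub_apply]
    rw [e1, e2, sub_self, sub_zero, hg, ← map_sub]
    exact norm_apply_le_of_norm_le_one (hc _) _
  have := constant_of_has_deriv_right_zero hcont.continuousOn hder t ⟨t.2, le_rfl⟩
  simpa [hg, orbit, hS.map_zero, hU.map_zero] using this

/-- The Laplace transform of a contraction semigroup is the resolvent of its generator. -/
theorem integral_exp_smul_orbit [CompleteSpace E] {U : ℝ≥0 → E →L[𝕜] E} (hU : IsC0Semigroup U)
    (hc : ∀ s, ‖U s‖ ≤ 1) {p : E × E} (hp : p ∈ generatorGraph U) {c : ℝ} (hc0 : 0 < c) :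
    ∫ s in Ioi (0 : ℝ), Real.exp (-(c * s)) • orbit U (c • p.1 - p.2) s = p.1 := by
  have hint := integrableOn_exp_smul_of_bounded (hU.continuous_orbit (c • p.1 - p.2))
    (fun s _ => norm_orbit_le hc (c • p.1 - p.2) s) hc0
  have h1 := intervalIntegral_tendsto_integral_Ioi (0 : ℝ) hint tendsto_id
  refine tendsto_nhds_unique h1 ?_
  -- The integrand has the explicit antiderivative `-e^{-cs} U_s p`, which vanishes at infinity.
  have hd : ∀ x : ℝ, 0 ≤ x → HasDerivWithinAt (fun s => -(Real.exp (-(c * s)) • orbit U p.1 s))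
      (Real.exp (-(c * x)) • orbit U (c • p.1 - p.2) x) (Ici x) x := by
    intro x hx
    have d1 : HasDerivAt (fun s : ℝ => Real.exp (-(c * s))) (Real.exp (-(c * x)) * -c) x := by
      have := ((hasDerivAt_id x).const_mul c).neg.exp
      simpa using this
    have d2 := (d1.hasDerivWithinAt.smul (hasDerivWithinAt_orbit hU hp hx)).neg
    refine d2.congr_deriv ?_
    simp only [orbit, map_sub, ContinuousLinearMap.map_smul_of_tower]
    rw [smul_sub, smul_smul, mul_neg, neg_smul]
    abel
  have h2 : ∀ t : ℝ, 0 ≤ t → ∫ s in (0 : ℝ)..t, Real.exp (-(c * s)) • orbit U (c • p.1 - p.2) s =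
      -(Real.exp (-(c * t)) • orbit U p.1 t) + p.1 := by
    intro t ht
    rw [intervalIntegral.integral_eq_sub_of_hasDeriv_right_of_le ht (f := fun s =>
      -(Real.exp (-(c * s)) • orbit U p.1 s))]
    · simp [hU.orbit_zero]
    · have := hU.continuous_orbit p.1
      exact Continuous.continuousOn (by fun_prop)
    · exact fun x hx => (hd x hx.1.le).mono Ioi_subset_Ici_self
    · have := hU.continuous_orbit (c • p.1 - p.2)
      exact Continuous.intervalIntegrable (by fun_prop) _ _
  have h3 : Tendsto (fun t : ℝ => -(Real.exp (-(c * t)) • orbit U p.1 t) + p.1) atTop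
      (𝓝 (-0 + p.1)) := by
    refine (Tendsto.neg ?_).add_const _
    have he : Tendsto (fun t : ℝ => Real.exp (-(c * t)) * ‖p.1‖) atTop (𝓝 (0 * ‖p.1‖)) :=
      (Real.tendsto_exp_neg_atTop_nhds_zero.comp (tendsto_id.const_mul_atTop hc0)).mul_const _
    rw [zero_mul] at he
    refine squeeze_zero_norm (fun t => ?_) he
    rw [norm_smul, Real.norm_of_nonneg (Real.exp_pos _).le]
    exact mul_le_mul_of_nonneg_left (norm_orbit_le hc _ _) (Real.exp_pos _).le
  rw [neg_zero, zero_add] at h3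
  refine h3.congr' ?_
  filter_upwards [eventually_ge_atTop 0] with t ht
  exact (h2 t ht).symm

end SemigroupTheory

/-! ### Generation of contraction semigroups -/

section Exponential

theorem hasDerivAt_comp_ofReal {𝕜 : Type*} [RCLike 𝕜] {E : Type*}
    [NormedAddCommGroup E] [NormedSpace 𝕜 E] [NormedSpace ℝ E] [IsScalarTower ℝ 𝕜 E]
    {f : 𝕜 → E} {f' : E} {t : ℝ} (h : HasDerivAt f f' (t : 𝕜)) :
    HasDerivAt (fun s : ℝ => f (s : 𝕜)) f' t := by
  have h1 : HasDerivAt (fun s : ℝ => (s : 𝕜)) 1 t := by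
    simpa using (RCLike.ofRealCLM (K := 𝕜)).hasDerivAt (x := t)
  have := HasDerivAt.scomp (h := fun s : ℝ => (s : 𝕜)) t h h1
  rwa [one_smul] at this

variable {𝕜 : Type*} [RCLike 𝕜] {E : Type*} [NormedAddCommGroup E] [NormedSpace 𝕜 E]

/-- Termwise comparison of power series. Only `‖1‖ ≤ 1` is used, so `E` may be trivial. -/
theorem norm_exp_le_exp_norm (A : E →L[𝕜] E) : ‖NormedSpace.exp A‖ ≤ Real.exp ‖A‖ := by
  rw [NormedSpace.exp_eq_tsum 𝕜]
  have h := NormedSpace.expSeries_div_hasSum_exp (𝔸 := ℝ) ‖A‖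
  rw [← Real.exp_eq_exp_ℝ] at h
  refine tsum_of_norm_bounded h fun n => ?_
  have hp : ‖A ^ n‖ ≤ ‖A‖ ^ n := by
    induction n with
    | zero =>
      rw [pow_zero, pow_zero, ContinuousLinearMap.one_def]
      exact ContinuousLinearMap.norm_id_le
    | succ n ih =>
      rw [pow_succ, pow_succ]
      exact (norm_mul_le _ _).trans (mul_le_mul_of_nonneg_right ih (norm_nonneg _))
  rw [norm_smul, div_eq_inv_mul]
  refine mul_le_mul (le_of_eq ?_) hp (norm_nonneg _) (by positivity)
  simp

variable [CompleteSpace E]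

theorem exp_smul_add (A : E →L[𝕜] E) (s t : 𝕜) :
    NormedSpace.exp ((s + t) • A) = NormedSpace.exp (s • A) * NormedSpace.exp (t • A) := by
  let : NormedAlgebra ℚ (E →L[𝕜] E) := NormedAlgebra.restrictScalars ℚ 𝕜 _
  rw [add_smul]
  exact NormedSpace.exp_add_of_commute (((Commute.refl A).smul_left s).smul_right t)

/-- For the Yosida approximation, the exponential factors as `e^{-tc} exp(t c² R)`, and the second
factor has norm at most `e^{tc}`. -/
theorem norm_exp_smul_sub_le_one {R : E →L[𝕜] E} {c : ℝ} (hc : 0 < c) (hR : ‖R‖ ≤ 1 / c) {t : ℝ}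
    (ht : 0 ≤ t) :
    ‖NormedSpace.exp ((t : 𝕜) • (((c ^ 2 : ℝ) : 𝕜) • R - (c : 𝕜) • (1 : E →L[𝕜] E)))‖ ≤ 1 := by
  let : NormedAlgebra ℚ (E →L[𝕜] E) := NormedAlgebra.restrictScalars ℚ 𝕜 _
  have e1 : (t : 𝕜) • (((c ^ 2 : ℝ) : 𝕜) • R - (c : 𝕜) • (1 : E →L[𝕜] E)) =
      ((t * c ^ 2 : ℝ) : 𝕜) • R + algebraMap 𝕜 (E →L[𝕜] E) ((-(t * c) : ℝ) : 𝕜) := by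
    rw [Algebra.algebraMap_eq_smul_one]
    push_cast
    module
  have e2 : NormedSpace.exp (algebraMap 𝕜 (E →L[𝕜] E) ((-(t * c) : ℝ) : 𝕜)) =
      ((Real.exp (-(t * c)) : ℝ) : 𝕜) • (1 : E →L[𝕜] E) := by
    rw [← NormedSpace.algebraMap_exp_comm, Algebra.algebraMap_eq_smul_one, Real.exp_eq_exp_ℝ,
      ← RCLike.algebraMap_eq_ofReal, NormedSpace.algebraMap_exp_comm]
  rw [e1, NormedSpace.exp_add_of_commute (Algebra.commute_algebraMap_right _ _), e2, mul_smul_comm,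
    mul_one, norm_smul, RCLike.norm_ofReal, abs_of_pos (Real.exp_pos _)]
  have h1 : ‖((t * c ^ 2 : ℝ) : 𝕜) • R‖ ≤ t * c := by
    rw [norm_smul, RCLike.norm_ofReal, abs_of_nonneg (by positivity)]
    refine (mul_le_mul_of_nonneg_left hR (by positivity)).trans (le_of_eq ?_)
    field_simp
  refine (mul_le_mul_of_nonneg_left ((norm_exp_le_exp_norm _).trans (Real.exp_le_exp.2 h1))
    (Real.exp_pos _).le).trans (le_of_eq ?_)
  rw [← Real.exp_add, neg_add_cancel, Real.exp_zero]

variable [NormedSpace ℝ E] [IsScalarTower ℝ 𝕜 E]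

/-- Interpolate by `z ↦ exp(zA) exp((t - z)B) v`. Since `A` and `B` commute, the derivative is a
product of contractions applied to `A v - B v`. -/
theorem norm_exp_smul_sub_exp_smul_le {A B : E →L[𝕜] E} (hAB : Commute A B)
    (hA : ∀ t : ℝ, 0 ≤ t → ‖NormedSpace.exp ((t : 𝕜) • A)‖ ≤ 1)
    (hB : ∀ t : ℝ, 0 ≤ t → ‖NormedSpace.exp ((t : 𝕜) • B)‖ ≤ 1) {t : ℝ} (ht : 0 ≤ t) (v : E) :
    ‖NormedSpace.exp ((t : 𝕜) • A) v - NormedSpace.exp ((t : 𝕜) • B) v‖ ≤ ‖A v - B v‖ * t := by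
  let : NormedAlgebra ℚ (E →L[𝕜] E) := NormedAlgebra.restrictScalars ℚ 𝕜 _
  set g : 𝕜 → E := fun z => NormedSpace.exp (z • A) (NormedSpace.exp (((t : 𝕜) - z) • B) v) with hg
  have hder : ∀ z : 𝕜, HasDerivAt g
      (NormedSpace.exp (z • A) (NormedSpace.exp (((t : 𝕜) - z) • B) (A v - B v))) z := by
    intro z
    have d1 := hasDerivAt_exp_smul_const A z
    have d2 : HasDerivAt (fun u : 𝕜 => NormedSpace.exp (((t : 𝕜) - u) • B))
        (-(NormedSpace.exp (((t : 𝕜) - z) • B) * B)) z := by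
      have := (hasDerivAt_exp_smul_const B ((t : 𝕜) - z)).scomp z
        ((hasDerivAt_id z).const_sub (t : 𝕜))
      rwa [neg_smul, one_smul] at this
    have d3 := d1.clm_apply (d2.clm_apply (hasDerivAt_const z v))
    refine d3.congr_deriv ?_
    have hc : A * NormedSpace.exp (((t : 𝕜) - z) • B) = NormedSpace.exp (((t : 𝕜) - z) • B) * A :=
      ((hAB.smul_right _).exp_right).eq
    have hc' : A (NormedSpace.exp (((t : 𝕜) - z) • B) v) =
        NormedSpace.exp (((t : 𝕜) - z) • B) (A v) := congrArg (fun C : E →L[𝕜] E => C v) hc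
    simp only [mul_apply_eq_comp, map_zero, add_zero, neg_apply,
      map_neg, map_sub, hc']
    abel
  have h1 := norm_image_sub_le_of_norm_deriv_le_segment' (a := 0) (b := t)
    (fun x _ => (hasDerivAt_comp_ofReal (hder (x : 𝕜))).hasDerivWithinAt) (C := ‖A v - B v‖)
    (fun x hx => ?_) t ⟨ht, le_rfl⟩
  · simpa [hg] using h1
  · refine (norm_apply_le_of_norm_le_one (hA x hx.1) _).trans ?_
    rw [← RCLike.ofReal_sub]
    exact norm_apply_le_of_norm_le_one (hB _ (sub_nonneg.2 hx.2.le)) _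

theorem hasDerivAt_exp_smul_apply (A : E →L[𝕜] E) (v : E) (t : ℝ) :
    HasDerivAt (fun s : ℝ => NormedSpace.exp ((s : 𝕜) • A) v)
      (NormedSpace.exp ((t : 𝕜) • A) (A v)) t := by
  have := (hasDerivAt_exp_smul_const A (t : 𝕜)).clm_apply (hasDerivAt_const (t : 𝕜) v)
  rw [map_zero, add_zero] at this
  exact hasDerivAt_comp_ofReal (f := fun z => NormedSpace.exp (z • A) v) this

theorem isC0Semigroup_exp (A : E →L[𝕜] E) :
    IsC0Semigroup fun t : ℝ≥0 => NormedSpace.exp (((t : ℝ) : 𝕜) • A) where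
  map_zero := by simp [ContinuousLinearMap.one_def]
  map_add s t := by
    rw [NNReal.coe_add, RCLike.ofReal_add, exp_smul_add]
    rfl
  continuous v := by
    have : Continuous fun s : ℝ => NormedSpace.exp ((s : 𝕜) • A) v :=
      continuous_iff_continuousAt.2 fun t => (hasDerivAt_exp_smul_apply A v t).continuousAt
    exact this.comp NNReal.continuous_coe

theorem mem_generatorGraph_exp (A : E →L[𝕜] E) (v : E) :
    (v, A v) ∈ generatorGraph fun t : ℝ≥0 => NormedSpace.exp (((t : ℝ) : 𝕜) • A) := by
  rw [mem_generatorGraph]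
  have h := (hasDerivAt_exp_smul_apply A v 0).hasDerivWithinAt (s := Ioi 0)
  rw [hasDerivWithinAt_iff_tendsto_slope' self_notMem_Ioi] at h
  simp only [RCLike.ofReal_zero, zero_smul, NormedSpace.exp_zero, one_apply_eq_self] at h
  refine h.congr' ?_
  filter_upwards [self_mem_nhdsWithin] with y hy
  simp [slope_def_module, orbit, (mem_Ioi.1 hy).le]

theorem norm_orbit_sub_orbit_le {U : ℝ≥0 → E →L[𝕜] E} (hU : IsC0Semigroup U)
    (hc : ∀ s, ‖U s‖ ≤ 1) {p : E × E} (hp : p ∈ generatorGraph U) {s t : ℝ} (hs : 0 ≤ s)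
    (ht : 0 ≤ t) : ‖orbit U p.1 t - orbit U p.1 s‖ ≤ ‖p.2‖ * |t - s| := by
  have hi := fun a b => (hU.continuous_orbit p.2).intervalIntegrable (μ := volume) a b
  have e : orbit U p.1 t - orbit U p.1 s = ∫ r in s..t, orbit U p.2 r := by
    rw [← intervalIntegral.integral_interval_sub_left (hi 0 t) (hi 0 s),
      integral_orbit_of_mem hU hp ht, integral_orbit_of_mem hU hp hs]
    abel
  rw [e]
  exact intervalIntegral.norm_integral_le_of_norm_le_const fun r _ => norm_orbit_le hc _ _

/-- Pointwise limits of contraction semigroups whose generators converge on a dense subspace. -/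
theorem exists_limit_semigroup {S : ℕ → ℝ≥0 → E →L[𝕜] E} (hS : ∀ n, IsC0Semigroup (S n))
    (hc : ∀ n s, ‖S n s‖ ≤ 1) (hcau : ∀ s v, CauchySeq fun n => S n s v) {T : Set (E × E)}
    (hT : Dense (Prod.fst '' T))
    (hgen : ∀ p ∈ T, ∃ w : ℕ → E, (∀ n, (p.1, w n) ∈ generatorGraph (S n)) ∧
      Tendsto w atTop (𝓝 p.2)) :
    ∃ V : ℝ≥0 → E →L[𝕜] E, IsC0Semigroup V ∧ (∀ s, ‖V s‖ ≤ 1) ∧ T ⊆ generatorGraph V := by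
  choose f hf using fun s v => cauchySeq_tendsto_of_complete (hcau s v)
  let V : ℝ≥0 → E →L[𝕜] E := fun s =>
    continuousLinearMapOfTendsto (S · s) (tendsto_pi_nhds.2 (hf s))
  have hV : ∀ s v, Tendsto (fun n => S n s v) atTop (𝓝 (V s v)) := hf
  have hVc : ∀ s, ‖V s‖ ≤ 1 := fun s => by
    refine ContinuousLinearMap.opNorm_le_bound _ zero_le_one fun v => ?_
    rw [one_mul]
    exact le_of_tendsto (hV s v).norm
      (Eventually.of_forall fun n => norm_apply_le_of_norm_le_one (hc n s) v)
  -- The Lipschitz constants of the orbits converge, so the bound survives. It gives strong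
  -- continuity of the limit on a dense set.
  have hlip : ∀ p ∈ T, ∀ s t : ℝ≥0, ‖V t p.1 - V s p.1‖ ≤ ‖p.2‖ * |(t : ℝ) - s| := by
    intro p hp s t
    obtain ⟨w, hw, hlim⟩ := hgen p hp
    refine le_of_tendsto_of_tendsto ((hV t p.1).sub (hV s p.1)).norm (hlim.norm.mul_const _)
      (Eventually.of_forall fun n => ?_)
    have := norm_orbit_sub_orbit_le (hS n) (hc n) (hw n) s.2 t.2
    simpa [orbit] using this
  have hVs : IsC0Semigroup V := by
    refine ⟨?_, ?_, ?_⟩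
    · ext v
      refine tendsto_nhds_unique (hV 0 v) ?_
      simp [(hS _).map_zero]
    · intro s t
      ext v
      refine tendsto_nhds_unique (hV (s + t) v) ?_
      have h1 : Tendsto (fun n => S n s (S n t v - V t v)) atTop (𝓝 0) := by
        have h2 := ((hV t v).sub_const (V t v)).norm
        rw [sub_self, norm_zero] at h2
        exact squeeze_zero_norm (fun n => norm_apply_le_of_norm_le_one (hc n s) _) h2
      have h3 := h1.add (hV s (V t v))
      rw [zero_add] at h3
      refine h3.congr fun n => ?_
      rw [map_sub, sub_add_cancel, (hS n).map_add]
      rfl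
    · intro v
      rw [continuous_iff_continuousAt]
      intro t
      rw [Metric.continuousAt_iff]
      intro ε hε
      obtain ⟨_, ⟨p, hp, rfl⟩, hpv⟩ := hT.exists_dist_lt v (show 0 < ε / 4 by positivity)
      rw [dist_eq_norm] at hpv
      refine ⟨ε / (4 * (‖p.2‖ + 1)), by positivity, fun {s} hs => ?_⟩
      have h1 := hlip p hp t s
      have h2 : ‖p.2‖ * |(s : ℝ) - t| ≤ ε / 4 := by
        rw [NNReal.dist_eq] at hs
        have h3 : (‖p.2‖ + 1) * |(s : ℝ) - t| ≤ (‖p.2‖ + 1) * (ε / (4 * (‖p.2‖ + 1))) :=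
          mul_le_mul_of_nonneg_left hs.le (by positivity)
        have h4 : (‖p.2‖ + 1) * (ε / (4 * (‖p.2‖ + 1))) = ε / 4 := by
          field_simp
        have := abs_nonneg ((s : ℝ) - t)
        linarith
      have e : V s v - V t v = V s (v - p.1) - V t (v - p.1) + (V s p.1 - V t p.1) := by
        simp only [map_sub]; abel
      rw [dist_eq_norm, e]
      have h5 := norm_apply_le_of_norm_le_one (hVc s) (v - p.1)
      have h6 := norm_apply_le_of_norm_le_one (hVc t) (v - p.1)
      have h7 := norm_add_le (V s (v - p.1) - V t (v - p.1)) (V s p.1 - V t p.1)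
      have h8 := norm_sub_le (V s (v - p.1)) (V t (v - p.1))
      linarith
  refine ⟨V, hVs, hVc, fun p hp => mem_generatorGraph_of_integral hVs fun t ht => ?_⟩
  obtain ⟨w, hw, hlim⟩ := hgen p hp
  -- Dominated convergence passes to the limit in the integral identity characterizing the
  -- generator.
  have h1 : Tendsto (fun n => ∫ s in (0 : ℝ)..t, orbit (S n) (w n) s) atTop
      (𝓝 (∫ s in (0 : ℝ)..t, orbit V p.2 s)) := by
    obtain ⟨C, hC⟩ := (hlim.norm).bddAbove_range
    refine intervalIntegral.tendsto_integral_filter_of_dominated_convergence (fun _ => C)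
      (Eventually.of_forall fun n => ((hS n).continuous_orbit (w n)).aestronglyMeasurable)
      (Eventually.of_forall fun n => Eventually.of_forall fun s _ =>
        (norm_orbit_le (hc n) _ _).trans (hC ⟨n, rfl⟩)) (by simp)
      (Eventually.of_forall fun s _ => ?_)
    have h2 : Tendsto (fun n => S n s.toNNReal (w n - p.2)) atTop (𝓝 0) := by
      have h3 := (hlim.sub_const p.2).norm
      rw [sub_self, norm_zero] at h3
      exact squeeze_zero_norm (fun n => norm_apply_le_of_norm_le_one (hc n _) _) h3
    have h4 := h2.add (hV s.toNNReal p.2)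
    rw [zero_add] at h4
    refine h4.congr fun n => ?_
    rw [map_sub, sub_add_cancel]
    rfl
  refine tendsto_nhds_unique h1 ?_
  refine ((hV t.toNNReal p.1).sub_const p.1).congr fun n => ?_
  rw [integral_orbit_of_mem (hS n) (hw n) ht]
  rfl

end Exponential

/-! ### Dissipative relations, resolvents and the Lumer-Phillips theorem -/

section HilleYosida

variable {𝕜 : Type*} [RCLike 𝕜] {E : Type*} [NormedAddCommGroup E] [NormedSpace 𝕜 E]

/-- Dissipativity of a linear relation. -/
def IsDissipative (T : Submodule 𝕜 (E × E)) : Prop :=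
  ∀ p ∈ T, ∀ c : ℝ, 0 < c → c * ‖p.1‖ ≤ ‖(c : 𝕜) • p.1 - p.2‖

theorem IsDissipative.eq_of_sub_eq {T : Submodule 𝕜 (E × E)} (hT : IsDissipative T) {p q : E × E}
    (hp : p ∈ T) (hq : q ∈ T) {c : ℝ} (hc : 0 < c)
    (h : (c : 𝕜) • p.1 - p.2 = (c : 𝕜) • q.1 - q.2) : p = q := by
  have h1 := hT _ (T.sub_mem hp hq) c hc
  have e : (c : 𝕜) • (p - q).1 - (p - q).2 = 0 := by
    rw [Prod.fst_sub, Prod.snd_sub, smul_sub]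
    rw [← sub_eq_zero] at h
    rw [← h]
    abel
  rw [e, norm_zero] at h1
  have h2 : ‖(p - q).1‖ ≤ 0 := by
    by_contra h3
    push Not at h3
    exact absurd h1 (not_le.2 (mul_pos hc h3))
  have h3 : p.1 = q.1 := sub_eq_zero.1 (norm_le_zero_iff.1 h2)
  rw [h3, sub_right_inj] at h
  exact Prod.ext h3 h

/-- Testing dissipativity on `p + c (0, w)` and letting `c → ∞` gives `‖p.1‖ ≤ ‖p.1 - w‖`. By
density this holds for every vector, in particular for `w` itself. -/
theorem IsDissipative.eq_zero_of_mem {T : Submodule 𝕜 (E × E)} (hT : IsDissipative T)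
    (hd : Dense (Prod.fst '' (T : Set (E × E)))) {w : E} (hw : ((0 : E), w) ∈ T) : w = 0 := by
  have key : ∀ y ∈ Prod.fst '' (T : Set (E × E)), ‖y‖ ≤ ‖y - w‖ := by
    rintro _ ⟨p, hp, rfl⟩
    -- The value of `c` below makes `‖p.2‖ ≤ c * ε`, so the error is at most `ε` after division by
    -- `c`.
    refine le_of_forall_pos_le_add fun ε hε => ?_
    set c : ℝ := (‖p.2‖ + 1) / ε with hc
    have hc0 : 0 < c := by positivity
    have h1 := hT _ (T.add_mem hp (T.smul_mem (c : 𝕜) hw)) c hc0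
    have e : (c : 𝕜) • (p + (c : 𝕜) • ((0 : E), w)).1 - (p + (c : 𝕜) • ((0 : E), w)).2 =
        (c : 𝕜) • (p.1 - w) - p.2 := by
      simp only [Prod.fst_add, Prod.snd_add, Prod.smul_fst, Prod.smul_snd]
      module
    have h2 := norm_sub_le ((c : 𝕜) • (p.1 - w)) p.2
    rw [norm_smul, RCLike.norm_ofReal, abs_of_pos hc0] at h2
    rw [e, Prod.fst_add, Prod.smul_fst, smul_zero, add_zero] at h1
    have h3 : c * ε = ‖p.2‖ + 1 := div_mul_cancel₀ _ hε.ne'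
    refine le_of_mul_le_mul_left ?_ hc0
    rw [mul_add]
    linarith
  have hcl : IsClosed {y : E | ‖y‖ ≤ ‖y - w‖} :=
    isClosed_le continuous_norm (continuous_id.sub continuous_const).norm
  have := hcl.closure_subset_iff.2 key (hd w)
  simpa using this

/-- On the complete space `T` the map `p ↦ c p.1 - p.2` is bounded below, because both components of
`p` are controlled by its value. Its range is therefore closed as well as dense. -/
theorem IsDissipative.rangeSub_eq_univ [CompleteSpace E] {T : Submodule 𝕜 (E × E)}
    (hT : IsDissipative T) (hcl : IsClosed (T : Set (E × E))) {c : ℝ} (hc : 0 < c)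
    (hd : Dense (rangeSub 𝕜 c (T : Set (E × E)))) (y : E) :
    ∃ p ∈ T, (c : 𝕜) • p.1 - p.2 = y := by
  have : CompleteSpace T := hcl.completeSpace_coe
  let f : T →L[𝕜] E := ((c : 𝕜) • ContinuousLinearMap.fst 𝕜 E E -
    ContinuousLinearMap.snd 𝕜 E E).comp T.subtypeL
  have hf : ∀ p : T, f p = (c : 𝕜) • (p : E × E).1 - (p : E × E).2 := fun p => rfl
  have ha : AntilipschitzWith (2 + ⟨c⁻¹, (inv_pos.2 hc).le⟩) f := by
    refine ContinuousLinearMap.antilipschitz_of_bound f fun p => ?_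
    have h1 := hT p p.2 c hc
    rw [← hf] at h1
    have h2 : ‖(p : E × E).1‖ ≤ c⁻¹ * ‖f p‖ := by
      rw [inv_mul_eq_div, le_div_iff₀ hc, mul_comm]
      exact h1
    have h3 : ‖(p : E × E).2‖ ≤ 2 * ‖f p‖ := by
      have e : (p : E × E).2 = (c : 𝕜) • (p : E × E).1 - f p := by rw [hf]; abel
      have h4 := norm_sub_le ((c : 𝕜) • (p : E × E).1) (f p)
      rw [← e, norm_smul, RCLike.norm_ofReal, abs_of_pos hc] at h4
      linarith
    have h5 : 0 ≤ ‖f p‖ := norm_nonneg _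
    have h6 : 0 ≤ c⁻¹ * ‖f p‖ := by positivity
    change ‖(p : E × E)‖ ≤ (2 + c⁻¹) * ‖f p‖
    rw [Prod.norm_def, add_mul]
    exact max_le (by linarith) (by linarith)
  have hr : rangeSub 𝕜 c (T : Set (E × E)) = range f := by
    ext z
    constructor
    · rintro ⟨p, hp, rfl⟩
      exact ⟨⟨p, hp⟩, rfl⟩
    · rintro ⟨p, rfl⟩
      exact ⟨p, p.2, rfl⟩
  have h := (ha.isClosed_range f.uniformContinuous).closure_eq
  rw [← hr, hd.closure_eq] at h
  have hy : y ∈ rangeSub 𝕜 c (T : Set (E × E)) := h ▸ mem_univ y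
  obtain ⟨p, hp, e⟩ := hy
  exact ⟨p, hp, e⟩

/-- Uniqueness of the preimage makes its choice linear; the norm bound is dissipativity itself. -/
theorem IsDissipative.exists_resolvent {T : Submodule 𝕜 (E × E)}
    (hT : IsDissipative T) {c : ℝ} (hc : 0 < c)
    (hs : ∀ y, ∃ p ∈ T, (c : 𝕜) • p.1 - p.2 = y) :
    ∃ R : E →L[𝕜] E, ‖R‖ ≤ 1 / c ∧ (∀ y, (R y, (c : 𝕜) • R y - y) ∈ T) ∧
      ∀ p ∈ T, R ((c : 𝕜) • p.1 - p.2) = p.1 := by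
  choose r hrT hr using hs
  have hu : ∀ p ∈ T, r ((c : 𝕜) • p.1 - p.2) = p := fun p hp =>
    hT.eq_of_sub_eq (hrT _) hp hc (hr _)
  let R₀ : E →ₗ[𝕜] E :=
    { toFun := fun y => (r y).1
      map_add' := fun x y => by
        rw [← Prod.fst_add]
        congr 1
        refine hT.eq_of_sub_eq (hrT _) (T.add_mem (hrT x) (hrT y)) hc ?_
        rw [hr, Prod.fst_add, Prod.snd_add, smul_add, add_sub_add_comm, hr, hr]
      map_smul' := fun a y => by
        rw [RingHom.id_apply, ← Prod.smul_fst]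
        congr 1
        refine hT.eq_of_sub_eq (hrT _) (T.smul_mem a (hrT y)) hc ?_
        rw [hr, Prod.smul_fst, Prod.smul_snd, smul_comm, ← smul_sub, hr] }
  have hb : ∀ y, ‖R₀ y‖ ≤ 1 / c * ‖y‖ := fun y => by
    have := hT _ (hrT y) c hc
    rw [hr] at this
    change ‖(r y).1‖ ≤ _
    rw [div_mul_eq_mul_div, one_mul, le_div_iff₀ hc, mul_comm]
    exact this
  refine ⟨R₀.mkContinuous (1 / c) hb, LinearMap.mkContinuous_norm_le _ (by positivity) hb,
    fun y => ?_, fun p hp => ?_⟩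
  · have : ((r y).1, (c : 𝕜) • (r y).1 - y) = r y := by
      refine Prod.ext rfl ?_
      have := hr y
      rw [sub_eq_iff_eq_add] at this
      change (c : 𝕜) • (r y).1 - y = _
      rw [this]
      abel
    change ((r y).1, (c : 𝕜) • (r y).1 - y) ∈ T
    rw [this]
    exact hrT y
  · change (r _).1 = p.1
    rw [hu p hp]

/-- Neumann series: `d - T = (1 - (c - d) R)(c - T)` with `R` the resolvent at `c`, and `|c - d| ‖R‖
< 1`. -/
theorem IsDissipative.surjective_of_lt_two_mul [CompleteSpace E] {T : Submodule 𝕜 (E × E)}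
    (hT : IsDissipative T) {c d : ℝ} (hc : 0 < c)
    (hs : ∀ y, ∃ p ∈ T, (c : 𝕜) • p.1 - p.2 = y) (hd : 0 < d) (hdc : d < 2 * c) (y : E) :
    ∃ p ∈ T, (d : 𝕜) • p.1 - p.2 = y := by
  obtain ⟨R, hR, hRT, -⟩ := hT.exists_resolvent hc hs
  have hn : ‖((c - d : ℝ) : 𝕜) • R‖ < 1 := by
    rw [norm_smul, RCLike.norm_ofReal]
    have h1 : |c - d| < c := abs_lt.2 ⟨by linarith, by linarith⟩
    calc |c - d| * ‖R‖ ≤ |c - d| * (1 / c) := mul_le_mul_of_nonneg_left hR (abs_nonneg _)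
      _ < c * (1 / c) := mul_lt_mul_of_pos_right h1 (by positivity)
      _ = 1 := by field_simp
  obtain ⟨u, hu⟩ := isUnit_one_sub_of_norm_lt_one hn
  have h2 : (1 - ((c - d : ℝ) : 𝕜) • R) ((↑u⁻¹ : E →L[𝕜] E) y) = y := by
    rw [← hu, ← mul_apply_eq_comp, u.mul_inv, one_apply_eq_self]
  set z := (↑u⁻¹ : E →L[𝕜] E) y
  refine ⟨_, hRT z, ?_⟩
  rw [← h2]
  simp only [sub_apply, one_apply_eq_self,
    smul_apply, RCLike.ofReal_sub, sub_smul]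
  abel

theorem IsDissipative.surjective_of_pos [CompleteSpace E] {T : Submodule 𝕜 (E × E)}
    (hT : IsDissipative T) {c : ℝ} (hc : 0 < c)
    (hs : ∀ y, ∃ p ∈ T, (c : 𝕜) • p.1 - p.2 = y) {d : ℝ} (hd : 0 < d) (y : E) :
    ∃ p ∈ T, (d : 𝕜) • p.1 - p.2 = y := by
  have key : ∀ n : ℕ, ∀ d : ℝ, 0 < d → d < 2 ^ (n + 1) * c →
      ∀ y, ∃ p ∈ T, (d : 𝕜) • p.1 - p.2 = y := by
    intro n
    induction n with
    | zero =>
      intro d hd hdc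
      exact hT.surjective_of_lt_two_mul hc hs hd (by simpa using hdc)
    | succ n ih =>
      intro d hd hdc
      -- The new base point is the midpoint of `d / 2` and `2 ^ (n + 1) * c`: large enough to reach
      -- `d`, small enough for the induction hypothesis.
      refine hT.surjective_of_lt_two_mul (c := (d / 2 + 2 ^ (n + 1) * c) / 2) (by positivity)
        (ih _ (by positivity) ?_) hd ?_ <;>
      · rw [pow_succ, mul_right_comm] at hdc
        linarith
  obtain ⟨n, hn⟩ := pow_unbounded_of_one_lt (d / c) (one_lt_two)
  refine key n d hd ?_ y
  rw [div_lt_iff₀ hc] at hn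
  refine hn.trans_le (mul_le_mul_of_nonneg_right ?_ hc.le)
  exact pow_le_pow_right₀ one_le_two (Nat.le_succ n)

variable [NormedSpace ℝ E] [IsScalarTower ℝ 𝕜 E]

theorem isDissipative_generator {U : ℝ≥0 → E →L[𝕜] E} (hc : ∀ s, ‖U s‖ ≤ 1) {p : E × E}
    (hp : p ∈ generatorGraph U) {c : ℝ} (hc0 : 0 < c) :
    c * ‖p.1‖ ≤ ‖(c : 𝕜) • p.1 - p.2‖ := by
  have h := norm_le_norm_sub_smul hc hp (inv_pos.2 hc0)
  have e : (c : 𝕜) • p.1 - p.2 = c • (p.1 - c⁻¹ • p.2) := by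
    rw [smul_sub, smul_inv_smul₀ hc0.ne', RCLike.real_smul_eq_coe_smul (K := 𝕜)]
  rw [e, norm_smul, Real.norm_of_nonneg hc0.le]
  exact mul_le_mul_of_nonneg_left h hc0.le

/-- The theorem of Lumer and Phillips. -/
theorem IsDissipative.exists_semigroup [CompleteSpace E] {T : Submodule 𝕜 (E × E)}
    (hT : IsDissipative T) (hcl : IsClosed (T : Set (E × E)))
    (hdom : Dense (Prod.fst '' (T : Set (E × E)))) {c₀ : ℝ} (hc₀ : 0 < c₀)
    (hd : Dense (rangeSub 𝕜 c₀ (T : Set (E × E)))) :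
    ∃ S : ℝ≥0 → E →L[𝕜] E, IsC0Semigroup S ∧ (∀ s, ‖S s‖ ≤ 1) ∧
      generatorGraph S = (T : Set (E × E)) := by
  have hsurj : ∀ d : ℝ, 0 < d → ∀ y, ∃ p ∈ T, (d : 𝕜) • p.1 - p.2 = y := fun d hd' =>
    hT.surjective_of_pos hc₀ (hT.rangeSub_eq_univ hcl hc₀ hd) hd'
  have hpos : ∀ n : ℕ, (0 : ℝ) < (n : ℝ) + 1 := fun n => by positivity
  choose R hRn hRT hRinv using fun n : ℕ => hT.exists_resolvent (hpos n) (hsurj _ (hpos n))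
  -- Yosida approximations at the parameters `n + 1`, which are positive also for `n = 0`.
  let A : ℕ → E →L[𝕜] E := fun n => ((((n : ℝ) + 1) ^ 2 : ℝ) : 𝕜) • R n -
    (((n : ℝ) + 1 : ℝ) : 𝕜) • (1 : E →L[𝕜] E)
  have hcontr : ∀ n (t : ℝ), 0 ≤ t → ‖NormedSpace.exp ((t : 𝕜) • A n)‖ ≤ 1 := fun n t ht =>
    norm_exp_smul_sub_le_one (hpos n) (hRn n) ht
  -- The resolvent identity is antisymmetric in `n` and `m`; cancelling the factor `n - m` gives
  -- commutation.
  have hcomm : ∀ n m, Commute (R n) (R m) := by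
    have hid : ∀ (n m : ℕ) (y : E), (((n : ℝ) - m : ℝ) : 𝕜) • R n (R m y) = R m y - R n y := by
      intro n m y
      have h1 := hRinv n _ (hRT m y)
      simp only [map_sub, map_smul] at h1
      have h2 := congrArg (fun z => z - R n y) h1
      rw [← h2]
      push_cast
      module
    intro n m
    rcases eq_or_ne n m with rfl | hnm
    · exact Commute.refl _
    · ext y
      have h1 := hid n m y
      have h2 := hid m n y
      have hne : (((n : ℝ) - m : ℝ) : 𝕜) ≠ 0 := by
        rw [Ne, RCLike.ofReal_eq_zero, sub_eq_zero]
        exact_mod_cast hnm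
      have h3 : (((n : ℝ) - m : ℝ) : 𝕜) • (R n (R m y)) = (((n : ℝ) - m : ℝ) : 𝕜) • (R m (R n y)) := by
        rw [h1, ← neg_sub (R n y), ← h2, ← neg_smul]
        congr 1
        push_cast
        ring
      exact smul_right_injective E hne h3
  have hcommA : ∀ n m, Commute (A n) (A m) := fun n m =>
    (((hcomm n m).smul_left _).smul_right _ |>.sub_right
      ((Commute.one_right _).smul_right _)).sub_left
      (((Commute.one_left _).smul_left _))
  -- On the domain the approximation is `(n + 1) R n` applied to `T p.1`, and `(n + 1) R n` tends
  -- strongly to the identity.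
  have hAT : ∀ n, ∀ p ∈ T, A n p.1 = (((n : ℝ) + 1 : ℝ) : 𝕜) • R n p.2 := by
    intro n p hp
    have h1 := hRinv n p hp
    simp only [map_sub, map_smul] at h1
    have h2 := congrArg (fun z => (((n : ℝ) + 1 : ℝ) : 𝕜) • z) h1
    simp only [smul_sub] at h2
    simp only [A, sub_apply, smul_apply,
      one_apply_eq_self]
    rw [← h2, smul_smul, ← RCLike.ofReal_mul, ← sq]
    abel
  have hJn : ∀ (n : ℕ) (y : E), ‖(((n : ℝ) + 1 : ℝ) : 𝕜) • R n y‖ ≤ ‖y‖ := by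
    intro n y
    rw [norm_smul, RCLike.norm_ofReal, abs_of_pos (hpos n)]
    calc ((n : ℝ) + 1) * ‖R n y‖ ≤ ((n : ℝ) + 1) * (1 / ((n : ℝ) + 1) * ‖y‖) :=
          mul_le_mul_of_nonneg_left ((R n).le_of_opNorm_le (hRn n) y) (hpos n).le
      _ = ‖y‖ := by
          have := (hpos n).ne'
          field_simp
  have hJT : ∀ p ∈ T, Tendsto (fun n : ℕ => (((n : ℝ) + 1 : ℝ) : 𝕜) • R n p.1) atTop (𝓝 p.1) := by
    intro p hp
    rw [tendsto_iff_norm_sub_tendsto_zero]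
    have h0 := (tendsto_one_div_add_atTop_nhds_zero_nat (𝕜 := ℝ)).mul_const ‖p.2‖
    rw [zero_mul] at h0
    refine squeeze_zero (fun n => norm_nonneg _) (fun n => ?_) h0
    have h1 := hRinv n p hp
    simp only [map_sub, map_smul] at h1
    have e : (((n : ℝ) + 1 : ℝ) : 𝕜) • R n p.1 - p.1 = R n p.2 := by
      rw [sub_eq_iff_eq_add] at h1 ⊢
      rw [h1, add_comm]
    rw [e]
    exact (R n).le_of_opNorm_le (hRn n) _
  have hJ : ∀ y, Tendsto (fun n : ℕ => (((n : ℝ) + 1 : ℝ) : 𝕜) • R n y) atTop (𝓝 y) := by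
    intro y
    rw [Metric.tendsto_atTop]
    intro ε hε
    obtain ⟨_, ⟨p, hp, rfl⟩, hpy⟩ := hdom.exists_dist_lt y (show 0 < ε / 3 by positivity)
    obtain ⟨N, hN⟩ := Metric.tendsto_atTop.1 (hJT p hp) (ε / 3) (by positivity)
    refine ⟨N, fun n hn => ?_⟩
    have h1 := hN n hn
    have h2 := hJn n (y - p.1)
    rw [dist_eq_norm] at *
    have e : (((n : ℝ) + 1 : ℝ) : 𝕜) • R n y - y = (((n : ℝ) + 1 : ℝ) : 𝕜) • R n (y - p.1) +
        ((((n : ℝ) + 1 : ℝ) : 𝕜) • R n p.1 - p.1) - (y - p.1) := by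
      rw [map_sub, smul_sub]; abel
    rw [e]
    refine (norm_sub_le _ _).trans_lt ?_
    have := norm_add_le ((((n : ℝ) + 1 : ℝ) : 𝕜) • R n (y - p.1))
      ((((n : ℝ) + 1 : ℝ) : 𝕜) • R n p.1 - p.1)
    linarith
  have hAlim : ∀ p ∈ T, Tendsto (fun n => A n p.1) atTop (𝓝 p.2) := fun p hp =>
    (hJ p.2).congr fun n => (hAT n p hp).symm
  have hcau : ∀ (s : ℝ≥0) (v : E),
      CauchySeq fun n => NormedSpace.exp (((s : ℝ) : 𝕜) • A n) v := by
    intro s v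
    rw [Metric.cauchySeq_iff]
    intro ε hε
    obtain ⟨_, ⟨p, hp, rfl⟩, hpv⟩ := hdom.exists_dist_lt v (show 0 < ε / 3 by positivity)
    have hs : (0 : ℝ) < s + 1 := by positivity
    obtain ⟨N, hN⟩ := Metric.cauchySeq_iff.1 (hAlim p hp).cauchySeq (ε / 3 / (s + 1))
      (by positivity)
    refine ⟨N, fun n hn m hm => ?_⟩
    have h1 := hN n hn m hm
    rw [dist_eq_norm] at *
    have h2 := norm_exp_smul_sub_exp_smul_le (hcommA n m) (hcontr n) (hcontr m) s.coe_nonneg p.1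
    have h3 : ‖A n p.1 - A m p.1‖ * (s : ℝ) ≤ ε / 3 := by
      have h4 : ‖A n p.1 - A m p.1‖ * ((s : ℝ) + 1) < ε / 3 := (lt_div_iff₀ hs).1 h1
      have := norm_nonneg (A n p.1 - A m p.1)
      linarith
    have h5 := norm_apply_le_of_norm_le_one (hcontr n s s.coe_nonneg) (v - p.1)
    have h6 := norm_apply_le_of_norm_le_one (hcontr m s s.coe_nonneg) (v - p.1)
    have e : NormedSpace.exp (((s : ℝ) : 𝕜) • A n) v - NormedSpace.exp (((s : ℝ) : 𝕜) • A m) v =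
        NormedSpace.exp (((s : ℝ) : 𝕜) • A n) (v - p.1) +
        (NormedSpace.exp (((s : ℝ) : 𝕜) • A n) p.1 - NormedSpace.exp (((s : ℝ) : 𝕜) • A m) p.1) -
        NormedSpace.exp (((s : ℝ) : 𝕜) • A m) (v - p.1) := by
      simp only [map_sub]; abel
    rw [e]
    refine (norm_sub_le _ _).trans_lt ?_
    have h7 := norm_add_le (NormedSpace.exp (((s : ℝ) : 𝕜) • A n) (v - p.1))
      (NormedSpace.exp (((s : ℝ) : 𝕜) • A n) p.1 - NormedSpace.exp (((s : ℝ) : 𝕜) • A m) p.1)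
    change ‖NormedSpace.exp (((s : ℝ) : 𝕜) • A n) p.1 -
      NormedSpace.exp (((s : ℝ) : 𝕜) • A m) p.1‖ ≤ _ at h2
    linarith
  obtain ⟨S, hS, hSc, hTS⟩ := exists_limit_semigroup (fun n => isC0Semigroup_exp (A n))
    (fun n s => hcontr n s s.2) hcau hdom
    (fun p hp => ⟨fun n => A n p.1, fun n => mem_generatorGraph_exp (A n) p.1, hAlim p hp⟩)
  refine ⟨S, hS, hSc, Subset.antisymm (fun p hp => ?_) hTS⟩
  -- The generator of `S` cannot be a proper extension: `1 - T` is already onto, and `1` minus the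
  -- generator is injective by dissipativity.
  obtain ⟨q, hq, hqp⟩ := hsurj 1 one_pos (((1 : ℝ) : 𝕜) • p.1 - p.2)
  have hm : p + (-1 : 𝕜) • q ∈ generatorGraph S :=
    generatorGraph_add_mem hp (generatorGraph_smul_mem (-1) (hTS hq))
  have h1 := isDissipative_generator hSc hm one_pos
  have e : ((1 : ℝ) : 𝕜) • (p + (-1 : 𝕜) • q).1 - (p + (-1 : 𝕜) • q).2 = 0 := by
    rw [← sub_eq_zero] at hqp
    rw [← neg_eq_zero, ← hqp]
    simp only [Prod.fst_add, Prod.snd_add, Prod.smul_fst, Prod.smul_snd]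
    module
  rw [e, norm_zero, one_mul] at h1
  have h2 : p.1 = q.1 := by
    have := norm_le_zero_iff.1 h1
    rw [Prod.fst_add, Prod.smul_fst, neg_smul, one_smul, ← sub_eq_add_neg] at this
    exact sub_eq_zero.1 this
  have h3 : p = q := by
    refine Prod.ext h2 ?_
    rw [h2, sub_right_inj] at hqp
    exact hqp.symm
  rw [h3]
  exact hq

end HilleYosida

/-! ### Inversion of the Laplace transform along bounded equicontinuous sequences -/

section LaplaceInversion

variable {F : ℕ → Type*} [∀ n, NormedAddCommGroup (F n)] [∀ n, NormedSpace ℝ (F n)]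

theorem integrableOn_exp_mul_comp_exp_smul {G : Type*} [NormedAddCommGroup G] [NormedSpace ℝ G]
    {f : ℝ → G} (hf : Continuous f) {C : ℝ} (hC : ∀ s, ‖f s‖ ≤ C) {h : ℝ → ℝ}
    (hh : Continuous h) :
    IntegrableOn (fun s => (Real.exp (-s) * h (Real.exp (-s))) • f s) (Ioi 0) := by
  obtain ⟨B, hB⟩ := (isCompact_Icc (a := (0 : ℝ)) (b := 1)).exists_bound_of_continuousOn
    hh.continuousOn
  have hB0 : 0 ≤ B := (norm_nonneg _).trans (hB 0 ⟨le_rfl, zero_le_one⟩)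
  have := integrableOn_exp_smul_of_bounded (f := fun s => h (Real.exp (-s)) • f s)
    (by fun_prop) (C := B * C) (fun s hs => by
      rw [norm_smul]
      exact mul_le_mul (hB _ ⟨(Real.exp_pos _).le, Real.exp_le_one_iff.2 (by linarith)⟩) (hC s)
        (norm_nonneg _) hB0) one_pos
  simpa only [one_mul, smul_smul] using this

variable {f : ∀ n, ℝ → F n} (hf : ∀ n, Continuous (f n)) {C : ℝ} (hC : ∀ n s, ‖f n s‖ ≤ C)
  (hL : ∀ c : ℝ, 0 < c →
    Tendsto (fun n => ‖∫ s in Ioi (0 : ℝ), Real.exp (-(c * s)) • f n s‖) atTop (𝓝 0))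

include hf hC hL

/-- A monomial of degree `k` in `e^{-s}`, with the extra weight `e^{-s}`, gives the Laplace
transform at `k + 1 > 0`. Each `f n` has its own target space, so convergence is stated for norms.
-/
theorem tendsto_integral_polynomial (P : Polynomial ℝ) :
    Tendsto (fun n => ‖∫ s in Ioi (0 : ℝ), (Real.exp (-s) * P.eval (Real.exp (-s))) • f n s‖)
      atTop (𝓝 0) := by
  induction P using Polynomial.induction_on' with
  | add p q hp hq =>
    have h := hp.add hq
    rw [add_zero] at h
    refine squeeze_zero (fun n => norm_nonneg _) (fun n => ?_) h
    have e : ∫ s in Ioi (0 : ℝ), (Real.exp (-s) * (p + q).eval (Real.exp (-s))) • f n s =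
        (∫ s in Ioi (0 : ℝ), (Real.exp (-s) * p.eval (Real.exp (-s))) • f n s) +
        ∫ s in Ioi (0 : ℝ), (Real.exp (-s) * q.eval (Real.exp (-s))) • f n s := by
      rw [← integral_add (integrableOn_exp_mul_comp_exp_smul (hf n) (hC n) p.continuous)
        (integrableOn_exp_mul_comp_exp_smul (hf n) (hC n) q.continuous)]
      simp only [Polynomial.eval_add, mul_add, add_smul]
    rw [e]
    exact norm_add_le _ _
  | monomial k a =>
    have h := (hL (k + 1) (by positivity)).const_mul ‖a‖
    rw [mul_zero] at h
    refine h.congr fun n => ?_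
    rw [← norm_smul, ← integral_smul]
    congr 2
    ext s
    rw [smul_smul, Polynomial.eval_monomial, ← Real.exp_nat_mul, mul_left_comm, ← Real.exp_add]
    congr 3
    ring_nf

/-- Weierstrass approximation of `h` on `[0, 1]`, the range of `e^{-s}`; the weight `e^{-s}` has
total mass one, so the error is uniform in `n`. -/
theorem tendsto_integral_continuous {h : ℝ → ℝ} (hh : Continuous h) :
    Tendsto (fun n => ‖∫ s in Ioi (0 : ℝ), (Real.exp (-s) * h (Real.exp (-s))) • f n s‖)
      atTop (𝓝 0) := by
  have hC0 : 0 ≤ C := (norm_nonneg _).trans (hC 0 0)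
  rw [Metric.tendsto_atTop]
  intro ε hε
  obtain ⟨P, hP⟩ := exists_polynomial_near_of_continuousOn 0 1 h hh.continuousOn
    (ε / (2 * (C + 1))) (by positivity)
  obtain ⟨N, hN⟩ := Metric.tendsto_atTop.1 (tendsto_integral_polynomial hf hC hL P) (ε / 2)
    (by positivity)
  refine ⟨N, fun n hn => ?_⟩
  have h1 := hN n hn
  rw [Real.dist_eq, sub_zero, abs_norm] at h1 ⊢
  have iP := integrableOn_exp_mul_comp_exp_smul (hf n) (hC n) P.continuous
  have ih := integrableOn_exp_mul_comp_exp_smul (hf n) (hC n) hh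
  have h2 : ‖(∫ s in Ioi (0 : ℝ), (Real.exp (-s) * P.eval (Real.exp (-s))) • f n s) -
      ∫ s in Ioi (0 : ℝ), (Real.exp (-s) * h (Real.exp (-s))) • f n s‖ ≤
      ε / (2 * (C + 1)) * C / 1 := by
    rw [← integral_sub iP ih]
    have e : ∀ s, (Real.exp (-s) * P.eval (Real.exp (-s))) • f n s -
        (Real.exp (-s) * h (Real.exp (-s))) • f n s =
        Real.exp (-(1 * s)) • ((P.eval (Real.exp (-s)) - h (Real.exp (-s))) • f n s) := by
      intro s
      rw [one_mul, smul_smul, ← sub_smul, mul_sub]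
    simp only [e]
    refine norm_integral_exp_smul_le (fun s hs => ?_) one_pos
    rw [norm_smul]
    exact mul_le_mul (hP _ ⟨(Real.exp_pos _).le, Real.exp_le_one_iff.2 (by linarith)⟩).le (hC n s)
      (norm_nonneg _) (by positivity)
  have h3 : ε / (2 * (C + 1)) * C / 1 ≤ ε / 2 := by
    rw [div_one, div_mul_eq_mul_div, div_le_div_iff₀ (by positivity) (by positivity)]
    nlinarith
  have h4 := norm_sub_norm_le (∫ s in Ioi (0 : ℝ), (Real.exp (-s) * h (Real.exp (-s))) • f n s)
    (∫ s in Ioi (0 : ℝ), (Real.exp (-s) * P.eval (Real.exp (-s))) • f n s)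
  rw [norm_sub_rev] at h4
  linarith

/-- A bounded equicontinuous sequence whose Laplace transforms tend to zero tends to zero. -/
theorem tendsto_of_tendsto_laplace [∀ n, CompleteSpace (F n)] {s₀ : ℝ} (hs₀ : 0 ≤ s₀)
    (heq : ∀ ε : ℝ, 0 < ε → ∃ δ > 0, ∀ s, |s - s₀| < δ → ∀ n, ‖f n s - f n s₀‖ ≤ ε) :
    Tendsto (fun n => ‖f n s₀‖) atTop (𝓝 0) := by
  rw [Metric.tendsto_atTop]
  intro ε hε
  obtain ⟨δ, hδ, hfδ⟩ := heq (ε / 2) (by positivity)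
  -- The bump is centred at the image of `s₀ + δ / 2`, and `r` confines its support to `s₀ < s < s₀
  -- + δ`. It thus has positive mass on `(0, ∞)` even when `s₀ = 0`.
  set m : ℝ := Real.exp (-(s₀ + δ / 2)) with hm
  set r : ℝ := min (m - Real.exp (-(s₀ + δ))) (Real.exp (-s₀) - m) with hr
  have hr0 : 0 < r := lt_min (sub_pos.2 (Real.exp_lt_exp.2 (by linarith)))
    (sub_pos.2 (Real.exp_lt_exp.2 (by linarith)))
  set h : ℝ → ℝ := fun x => max 0 (r - |x - m|) with hh
  have hcont : Continuous h := by fun_prop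
  have hsupp : ∀ s, h (Real.exp (-s)) ≠ 0 → |s - s₀| < δ := by
    intro s hs
    have h1 : |Real.exp (-s) - m| < r := by
      by_contra h2
      exact hs (max_eq_left (by linarith))
    have h2 := abs_lt.1 h1
    have h3 : r ≤ m - Real.exp (-(s₀ + δ)) := min_le_left _ _
    have h4 : r ≤ Real.exp (-s₀) - m := min_le_right _ _
    have h5 : -(s₀ + δ) < -s := Real.exp_lt_exp.1 (by linarith)
    have h6 : -s < -s₀ := Real.exp_lt_exp.1 (by linarith)
    rw [abs_lt]
    constructor <;> linarith
  set w : ℝ → ℝ := fun s => Real.exp (-s) * h (Real.exp (-s)) with hw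
  have hw0 : ∀ s, 0 ≤ w s := fun s => mul_nonneg (Real.exp_pos _).le (le_max_left _ _)
  have hwc : Continuous w := by fun_prop
  have hwi : IntegrableOn w (Ioi 0) := by
    have := integrableOn_exp_mul_comp_exp_smul (f := fun _ => (1 : ℝ)) continuous_const (C := 1)
      (by simp) hcont
    simpa only [smul_eq_mul, mul_one] using this
  set I : ℝ := ∫ s in Ioi (0 : ℝ), w s with hI
  have hI0 : 0 < I := by
    rw [hI, setIntegral_pos_iff_support_of_nonneg_ae (Eventually.of_forall hw0) hwi]
    have ho : IsOpen (Function.support w ∩ Ioi 0) :=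
      (hwc.isOpen_preimage _ isOpen_compl_singleton).inter isOpen_Ioi
    refine ho.measure_pos volume ⟨s₀ + δ / 2, ?_, ?_⟩
    · simp only [Function.mem_support, hw, hh]
      rw [← hm, sub_self, abs_zero, sub_zero, max_eq_right hr0.le]
      positivity
    · exact mem_Ioi.2 (by linarith)
  obtain ⟨N, hN⟩ := Metric.tendsto_atTop.1 (tendsto_integral_continuous hf hC hL hcont)
    (I * (ε / 2)) (by positivity)
  refine ⟨N, fun n hn => ?_⟩
  have h1 := hN n hn
  rw [Real.dist_eq, sub_zero, abs_norm] at h1 ⊢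
  have i1 : IntegrableOn (fun s => w s • f n s) (Ioi 0) :=
    integrableOn_exp_mul_comp_exp_smul (hf n) (hC n) hcont
  have i2 : IntegrableOn (fun s => w s • f n s₀) (Ioi 0) := hwi.smul_const _
  -- On the support of the weight, equicontinuity allows `f n s` to be replaced by `f n s₀`,
  -- uniformly in `n`.
  have h2 : ‖(∫ s in Ioi (0 : ℝ), w s • f n s) - I • f n s₀‖ ≤ I * (ε / 2) := by
    rw [hI, ← integral_smul_const, ← integral_sub i1 i2, ← integral_mul_const]
    refine norm_integral_le_of_norm_le (hwi.mul_const _) (Eventually.of_forall fun s => ?_)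
    rw [← smul_sub, norm_smul, Real.norm_of_nonneg (hw0 s)]
    by_cases hs : h (Real.exp (-s)) = 0
    · simp [hw, hs]
    · exact mul_le_mul_of_nonneg_left (hfδ s (hsupp s hs) n) (hw0 s)
  have h3 := norm_sub_norm_le (I • f n s₀) (∫ s in Ioi (0 : ℝ), w s • f n s)
  rw [norm_sub_rev, norm_smul, Real.norm_of_nonneg hI0.le] at h3
  have h4 : I * ‖f n s₀‖ < I * ε := by
    have : ‖∫ s in Ioi (0 : ℝ), w s • f n s‖ < I * (ε / 2) := h1
    linarith
  exact lt_of_mul_lt_mul_left h4 hI0.le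

end LaplaceInversion

/-! ### Topologies of pointwise convergence on operators -/

section Pointwise

variable {𝕜 : Type*} [RCLike 𝕜] {E : Type*} [NormedAddCommGroup E] [NormedSpace 𝕜 E]
  {𝔖 : Set (Set E)}

/-- Evaluation at a point of a member of `𝔖`, as a continuous functional on `LS 𝕜 𝔖`. -/
def evalLS {b : Set E} (hb : b ∈ 𝔖) {y : E} (hy : y ∈ b) : LS 𝕜 𝔖 →L[𝕜] E where
  toFun A := A y
  map_add' _ _ := rfl
  map_smul' _ _ := rfl
  cont := continuous_iff_continuousAt.2 fun _ =>
    ((UniformConvergenceCLM.tendsto_iff_tendstoUniformlyOn (RingHom.id 𝕜) E 𝔖).1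
      tendsto_id b hb).tendsto_at hy

theorem continuous_apply_of_continuous_toLS {b : Set E} (hb : b ∈ 𝔖) {y : E} (hy : y ∈ b)
    {f : ℝ≥0 → E →L[𝕜] E} (hf : Continuous fun s => toLS 𝔖 (f s)) : Continuous fun s => f s y :=
  (evalLS hb hy).continuous.comp hf

/-- Uniform convergence on singletons is pointwise convergence, so strong continuity suffices. -/
theorem continuous_toLS_of_singletons (h𝔖 : ∀ b ∈ 𝔖, ∃ y, b = {y}) {f : ℝ≥0 → E →L[𝕜] E}
    (hf : ∀ v, Continuous fun s => f s v) : Continuous fun s => toLS 𝔖 (f s) := by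
  refine continuous_iff_continuousAt.2 fun t => ?_
  refine (UniformConvergenceCLM.tendsto_iff_tendstoUniformlyOn (RingHom.id 𝕜) E 𝔖).2
    fun b hb => ?_
  obtain ⟨y, rfl⟩ := h𝔖 b hb
  rw [tendstoUniformlyOn_singleton_iff_tendsto]
  exact (hf y).tendsto t

theorem hasLaplace_laplace {f : ℝ≥0 → E →L[𝕜] E} {c : ℝ} (h : ∃ A, HasLaplace 𝔖 f c A) :
    HasLaplace 𝔖 f c (laplace 𝔖 f c) := by
  rw [laplace, dif_pos h]
  exact h.choose_spec

variable [NormedSpace ℝ E] [IsScalarTower ℝ 𝕜 E] [CompleteSpace E]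

/-- Functionals of the form `ℓ ∘ evaluation at y` are among those testing the weak integral, and
such `ℓ` separate the points of `E`. -/
theorem HasLaplace.apply_eq_integral {f : ℝ≥0 → E →L[𝕜] E} {c : ℝ} {A : E →L[𝕜] E}
    (h : HasLaplace 𝔖 f c A) {b : Set E} (hb : b ∈ 𝔖) {y : E} (hy : y ∈ b)
    (hint : IntegrableOn (fun s : ℝ => Real.exp (-(c * s)) • f s.toNNReal y) (Ioi 0)) :
    A y = ∫ s in Ioi (0 : ℝ), Real.exp (-(c * s)) • f s.toNNReal y := by
  refine (SeparatingDual.eq_iff_forall_dual_eq (R := 𝕜)).2 fun ℓ => ?_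
  have h1 := (h (ℓ.comp (evalLS hb hy))).2
  have h2 := ContinuousLinearMap.integral_comp_comm ℓ hint
  rw [← h2]
  refine h1.symm.trans (integral_congr_ae (Eventually.of_forall fun s => ?_))
  simp only [RCLike.real_smul_eq_coe_smul (K := 𝕜), map_smul, smul_eq_mul]
  rfl

end Pointwise

/-! ### Continuity of selections of a Banach bundle at a point -/

section Selections

variable {X : Type*} [TopologicalSpace X] {E : X → Type*} [∀ x, NormedAddCommGroup (E x)]
  {𝕜 : Type*} [RCLike 𝕜] [∀ x, NormedSpace 𝕜 (E x)] {τ : TopologicalSpace (Tot E)}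

/-- The selection `w` is approximated near `x` by bounded continuous selections. -/
def ContAt (τ : TopologicalSpace (Tot E)) (w : ∀ x, E x) (x : X) : Prop :=
  ∀ ε : ℝ, 0 < ε → ∃ σ ∈ (normed τ).Gamma, ‖w x - σ x‖ < ε ∧ ∀ᶠ z in 𝓝 x, ‖w z - σ z‖ < ε

theorem isBdd_normed {X : Type*} {E : X → Type*} [∀ x, NormedAddCommGroup (E x)]
    {τ : TopologicalSpace (Tot E)} {w : ∀ x, E x} :
    (normed τ).IsBdd w ↔ ∃ C : ℝ, ∀ x, ‖w x‖ ≤ C :=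
  ⟨fun h => (h PUnit.unit).imp fun C hC x => hC ⟨x, rfl⟩,
    fun ⟨C, hC⟩ _ => ⟨C, by rintro _ ⟨x, rfl⟩; exact hC x⟩⟩

theorem contAt_of_mem_Gamma {σ : ∀ x, E x} (hσ : σ ∈ (normed τ).Gamma) (x : X) :
    ContAt τ σ x := fun ε hε => ⟨σ, hσ, by simpa, by simpa⟩

theorem ContAt.of_approx {w : ∀ x, E x} {x : X} (h : ∀ ε : ℝ, 0 < ε → ∃ w' : ∀ x, E x,
    ContAt τ w' x ∧ ‖w x - w' x‖ < ε ∧ ∀ᶠ z in 𝓝 x, ‖w z - w' z‖ < ε) : ContAt τ w x := by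
  intro ε hε
  obtain ⟨w', hw', h1, h2⟩ := h (ε / 2) (by positivity)
  obtain ⟨σ, hσ, h3, h4⟩ := hw' (ε / 2) (by positivity)
  have key : ∀ z, ‖w z - w' z‖ < ε / 2 → ‖w' z - σ z‖ < ε / 2 → ‖w z - σ z‖ < ε := by
    intro z h5 h6
    have := norm_sub_le_norm_sub_add_norm_sub (w z) (w' z) (σ z)
    linarith
  exact ⟨σ, hσ, key x h1 h3, by filter_upwards [h2, h4] with z h5 h6 using key z h5 h6⟩

theorem ContAt.congr {w w' : ∀ x, E x} {x : X} (h : ContAt τ w x) (he : ∀ᶠ z in 𝓝 x, w' z = w z) :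
    ContAt τ w' x := by
  refine ContAt.of_approx fun ε hε => ⟨w, h, ?_, ?_⟩
  · simpa [he.self_of_nhds]
  · filter_upwards [he] with z hz
    simpa [hz]

theorem Gamma_smul_mem (hV : IsBanachBundle 𝕜 τ) {σ : ∀ x, E x} (hσ : σ ∈ (normed τ).Gamma)
    (c : 𝕜) : (fun x => c • σ x) ∈ (normed τ).Gamma := by
  refine ⟨?_, ?_⟩
  · obtain ⟨C, hC⟩ := isBdd_normed.1 hσ.1
    exact isBdd_normed.2 ⟨‖c‖ * C, fun x => by
      rw [norm_smul]; exact mul_le_mul_of_nonneg_left (hC x) (norm_nonneg _)⟩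
  · let _ : TopologicalSpace (Tot E) := τ
    have h1 : Continuous fun x => (c, graphMap σ x) := continuous_const.prodMk hσ.2
    exact hV.isOmegaBundle.continuous_smul.comp h1

theorem Gamma_add_mem (hV : IsBanachBundle 𝕜 τ) {σ σ' : ∀ x, E x} (hσ : σ ∈ (normed τ).Gamma)
    (hσ' : σ' ∈ (normed τ).Gamma) : (fun x => σ x + σ' x) ∈ (normed τ).Gamma := by
  refine ⟨?_, ?_⟩
  · obtain ⟨C, hC⟩ := isBdd_normed.1 hσ.1
    obtain ⟨C', hC'⟩ := isBdd_normed.1 hσ'.1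
    exact isBdd_normed.2 ⟨C + C', fun x =>
      (norm_add_le _ _).trans (add_le_add (hC x) (hC' x))⟩
  · let _ : TopologicalSpace (Tot E) := τ
    let _ : TopologicalSpace (Tot fun x => E x × E x) := TopologicalSpace.induced
      (fun p => ((⟨p.proj, p.snd.1⟩, ⟨p.proj, p.snd.2⟩) : Tot E × Tot E)) inferInstance
    have h1 : Continuous (graphMap fun x => (σ x, σ' x)) :=
      continuous_induced_rng.2 (Continuous.prodMk hσ.2 hσ'.2)
    exact hV.isOmegaBundle.continuous_add.comp h1

theorem tendsto_norm_of_mem_Gamma (hV : IsBanachBundle 𝕜 τ) {σ : ∀ x, E x}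
    (hσ : σ ∈ (normed τ).Gamma) (x : X) : Tendsto (fun z => ‖σ z‖) (𝓝 x) (𝓝 ‖σ x‖) := by
  let _ : TopologicalSpace (Tot E) := τ
  have h2 : Continuous (graphMap σ) := hσ.2
  exact (hV.continuous_norm.comp h2).tendsto x

theorem exists_mem_Gamma_near (hV : IsBanachBundle 𝕜 τ) (x : X) (v : E x) {ε : ℝ} (hε : 0 < ε) :
    ∃ σ ∈ (normed τ).Gamma, ‖v - σ x‖ < ε :=
  hV.isOmegaBundle.dense_sections x v PUnit.unit ε hε

theorem zero_mem_Gamma (hV : IsBanachBundle 𝕜 τ) (x : X) :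
    (fun x => (0 : E x)) ∈ (normed τ).Gamma := by
  obtain ⟨σ, hσ, -⟩ := exists_mem_Gamma_near hV x 0 one_pos
  simpa using Gamma_smul_mem hV hσ (0 : 𝕜)

theorem ContAt.add (hV : IsBanachBundle 𝕜 τ) {w w' : ∀ x, E x} {x : X} (h : ContAt τ w x)
    (h' : ContAt τ w' x) : ContAt τ (fun z => w z + w' z) x := by
  intro ε hε
  obtain ⟨σ, hσ, h1, h2⟩ := h (ε / 2) (by positivity)
  obtain ⟨σ', hσ', h3, h4⟩ := h' (ε / 2) (by positivity)
  have key : ∀ z, ‖w z - σ z‖ < ε / 2 → ‖w' z - σ' z‖ < ε / 2 →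
      ‖w z + w' z - (σ z + σ' z)‖ < ε := by
    intro z h5 h6
    rw [add_sub_add_comm]
    have := norm_add_le (w z - σ z) (w' z - σ' z)
    linarith
  exact ⟨_, Gamma_add_mem hV hσ hσ', key x h1 h3, by
    filter_upwards [h2, h4] with z h5 h6 using key z h5 h6⟩

theorem ContAt.smul (hV : IsBanachBundle 𝕜 τ) {w : ∀ x, E x} {x : X} (h : ContAt τ w x) (c : 𝕜) :
    ContAt τ (fun z => c • w z) x := by
  intro ε hε
  obtain ⟨σ, hσ, h1, h2⟩ := h (ε / (‖c‖ + 1)) (by positivity)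
  have key : ∀ z, ‖w z - σ z‖ < ε / (‖c‖ + 1) → ‖c • w z - c • σ z‖ < ε := by
    intro z h5
    rw [lt_div_iff₀ (by positivity)] at h5
    rw [← smul_sub, norm_smul]
    have := norm_nonneg (w z - σ z)
    by_cases h0 : ‖w z - σ z‖ = 0
    · rw [h0, mul_zero]; exact hε
    · have : 0 < ‖w z - σ z‖ := lt_of_le_of_ne this (Ne.symm h0)
      linarith
  exact ⟨_, Gamma_smul_mem hV hσ c, key x h1, by filter_upwards [h2] with z h5 using key z h5⟩

theorem ContAt.sub (hV : IsBanachBundle 𝕜 τ) {w w' : ∀ x, E x} {x : X} (h : ContAt τ w x)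
    (h' : ContAt τ w' x) : ContAt τ (fun z => w z - w' z) x := by
  have := h.add hV (h'.smul hV (-1 : 𝕜))
  simpa [← sub_eq_add_neg] using this

theorem ContAt.tendsto_norm (hV : IsBanachBundle 𝕜 τ) {w : ∀ x, E x} {x : X} (h : ContAt τ w x) :
    Tendsto (fun z => ‖w z‖) (𝓝 x) (𝓝 ‖w x‖) := by
  rw [Metric.tendsto_nhds]
  intro ε hε
  obtain ⟨σ, hσ, h1, h2⟩ := h (ε / 3) (by positivity)
  have h3 := Metric.tendsto_nhds.1 (tendsto_norm_of_mem_Gamma hV hσ x) (ε / 3) (by positivity)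
  filter_upwards [h2, h3] with z h4 h5
  rw [Real.dist_eq, abs_lt] at *
  have h6 := abs_le.1 (abs_norm_sub_norm_le (w z) (σ z))
  have h7 := abs_le.1 (abs_norm_sub_norm_le (w x) (σ x))
  constructor <;> linarith [h6.1, h6.2, h7.1, h7.2, h5.1, h5.2]

/-- One direction applies continuity to a tube around a section close to `w x`. In the other, `‖w -
σ‖` is continuous at `x`, so a strict inequality defining a tube persists nearby. -/
theorem continuousAt_graphMap_iff (hV : IsBanachBundle 𝕜 τ) {w : ∀ x, E x} {x : X} :
    @ContinuousAt X (Tot E) _ τ (graphMap w) x ↔ ContAt τ w x := by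
  constructor
  · intro h ε hε
    obtain ⟨σ, hσ, h1⟩ := exists_mem_Gamma_near hV x (w x) hε
    refine ⟨σ, hσ, h1, ?_⟩
    have h2 : tube (normed τ).sn univ σ ε PUnit.unit ∈ @nhds _ τ (graphMap w x) :=
      (hV.isOmegaBundle.nhds_iff _ _).2
        ⟨univ, σ, ε, PUnit.unit, isOpen_univ, hσ, hε, ⟨mem_univ _, h1⟩, Subset.rfl⟩
    filter_upwards [h h2] with z hz using hz.2
  · intro h s hs
    obtain ⟨U, σ, ε, j, hU, hσ, hε, ⟨hxU, hx⟩, hsub⟩ := (hV.isOmegaBundle.nhds_iff _ _).1 hs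
    have h1 := (h.sub hV (contAt_of_mem_Gamma hσ x)).tendsto_norm hV
    have hx' : ‖w x - σ x‖ < ε := hx
    have h2 : ∀ᶠ z in 𝓝 x, graphMap w z ∈ s := by
      filter_upwards [h1.eventually_lt_const hx', hU.mem_nhds hxU] with z h3 h4
      exact hsub ⟨h4, h3⟩
    exact h2

theorem mem_GammaAt_iff (hV : IsBanachBundle 𝕜 τ) {w : ∀ x, E x} {x : X} :
    w ∈ (normed τ).GammaAt x ↔ (∃ C : ℝ, ∀ x, ‖w x‖ ≤ C) ∧ ContAt τ w x :=
  and_congr isBdd_normed (continuousAt_graphMap_iff hV)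

theorem mem_span_directSum_iff (hV : IsBanachBundle 𝕜 τ) (x : X) {f : ∀ x, E x × E x} :
    f ∈ Submodule.span 𝕜
      ({f | ∃ σ ∈ (normed τ).Gamma, f = fun x => (σ x, 0)} ∪
        {f | ∃ σ ∈ (normed τ).Gamma, f = fun x => (0, σ x)} : Set (∀ x, E x × E x)) ↔
    (fun x => (f x).1) ∈ (normed τ).Gamma ∧ (fun x => (f x).2) ∈ (normed τ).Gamma := by
  constructor
  · intro h
    induction h using Submodule.span_induction with
    | mem g hg =>
      rcases hg with ⟨σ, hσ, rfl⟩ | ⟨σ, hσ, rfl⟩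
      · exact ⟨hσ, zero_mem_Gamma hV x⟩
      · exact ⟨zero_mem_Gamma hV x, hσ⟩
    | zero => exact ⟨zero_mem_Gamma hV x, zero_mem_Gamma hV x⟩
    | add g g' _ _ h1 h2 => exact ⟨Gamma_add_mem hV h1.1 h2.1, Gamma_add_mem hV h1.2 h2.2⟩
    | smul c g _ h1 => exact ⟨Gamma_smul_mem hV h1.1 c, Gamma_smul_mem hV h1.2 c⟩
  · rintro ⟨h1, h2⟩
    have e : f = (fun x => ((f x).1, (0 : E x))) + fun x => ((0 : E x), (f x).2) := by
      funext z
      simp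
    rw [e]
    exact Submodule.add_mem _ (Submodule.subset_span (Or.inl ⟨_, h1, rfl⟩))
      (Submodule.subset_span (Or.inr ⟨_, h2, rfl⟩))

/-- The sections defining the sum topology are exactly the pairs of members of `Γ(π)`, so continuity
can be tested componentwise. -/
theorem mem_GammaAt_directSum_iff (hV : IsBanachBundle 𝕜 τ) {φ : ∀ x, E x × E x} {x : X} :
    φ ∈ ((normed τ).directSum 𝕜 (normed τ)).GammaAt x ↔
      (∃ C : ℝ, ∀ x, ‖φ x‖ ≤ C) ∧ ContAt τ (fun z => (φ z).1) x ∧ ContAt τ (fun z => (φ z).2) x := by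
  refine and_congr ?_ ?_
  · constructor
    · intro h
      obtain ⟨C, hC⟩ := h (PUnit.unit, PUnit.unit)
      refine ⟨C, fun z => ?_⟩
      have h1 : ‖(φ z).1‖ + ‖(φ z).2‖ ≤ C := hC ⟨z, rfl⟩
      have := norm_nonneg (φ z).1
      have := norm_nonneg (φ z).2
      rw [Prod.norm_def]
      exact max_le (by linarith) (by linarith)
    · rintro ⟨C, hC⟩ j
      refine ⟨C + C, ?_⟩
      rintro _ ⟨z, rfl⟩
      exact add_le_add ((norm_fst_le _).trans (hC z)) ((norm_snd_le _).trans (hC z))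
  · have hG : @ContinuousAt X (Tot fun x => E x × E x) _
        ((normed τ).directSum 𝕜 (normed τ)).top (graphMap φ) x ↔
        ∀ (U : Set X) (f : ∀ x, E x × E x) (ε : ℝ), IsOpen U →
          (fun x => (f x).1) ∈ (normed τ).Gamma → (fun x => (f x).2) ∈ (normed τ).Gamma → 0 < ε →
          x ∈ U → ‖(φ x).1 - (f x).1‖ + ‖(φ x).2 - (f x).2‖ < ε →
          ∀ᶠ z in 𝓝 x, z ∈ U ∧ ‖(φ z).1 - (f z).1‖ + ‖(φ z).2 - (f z).2‖ < ε := by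
      unfold ContinuousAt
      change Tendsto _ _ (@nhds _ (tubeTopology _ _) _) ↔ _
      rw [TopologicalSpace.tendsto_nhds_generateFrom_iff]
      constructor
      · intro h U f ε hU h1 h2 hε hx hxε
        exact h _ ⟨U, f, ε, (PUnit.unit, PUnit.unit), hU,
          (mem_span_directSum_iff hV x).2 ⟨h1, h2⟩, hε, rfl⟩ ⟨hx, hxε⟩
      · rintro h _ ⟨U, f, ε, j, hU, hf, hε, rfl⟩ ⟨hx, hxε⟩
        obtain ⟨h1, h2⟩ := (mem_span_directSum_iff hV x).1 hf
        exact h U f ε hU h1 h2 hε hx hxε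
    rw [hG]
    constructor
    · intro h
      have key : ∀ ε : ℝ, 0 < ε → ∃ σ ∈ (normed τ).Gamma, ∃ σ' ∈ (normed τ).Gamma,
          ‖(φ x).1 - σ x‖ + ‖(φ x).2 - σ' x‖ < ε ∧
          ∀ᶠ z in 𝓝 x, ‖(φ z).1 - σ z‖ + ‖(φ z).2 - σ' z‖ < ε := by
        intro ε hε
        obtain ⟨σ, hσ, h1⟩ := exists_mem_Gamma_near hV x (φ x).1 (half_pos hε)
        obtain ⟨σ', hσ', h2⟩ := exists_mem_Gamma_near hV x (φ x).2 (half_pos hε)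
        have h3 : ‖(φ x).1 - σ x‖ + ‖(φ x).2 - σ' x‖ < ε := by linarith
        refine ⟨σ, hσ, σ', hσ', h3, ?_⟩
        filter_upwards [h univ (fun x => (σ x, σ' x)) ε isOpen_univ hσ hσ' hε (mem_univ x) h3]
          with z hz using hz.2
      constructor
      · intro ε hε
        obtain ⟨σ, hσ, σ', hσ', h1, h2⟩ := key ε hε
        refine ⟨σ, hσ, lt_of_le_of_lt (le_add_of_nonneg_right (norm_nonneg _)) h1, ?_⟩
        filter_upwards [h2] with z hz
        exact lt_of_le_of_lt (le_add_of_nonneg_right (norm_nonneg _)) hz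
      · intro ε hε
        obtain ⟨σ, hσ, σ', hσ', h1, h2⟩ := key ε hε
        refine ⟨σ', hσ', lt_of_le_of_lt (le_add_of_nonneg_left (norm_nonneg _)) h1, ?_⟩
        filter_upwards [h2] with z hz
        exact lt_of_le_of_lt (le_add_of_nonneg_left (norm_nonneg _)) hz
    · rintro ⟨h1, h2⟩ U f ε hU hf1 hf2 hε hx hxε
      have h3 := ((h1.sub hV (contAt_of_mem_Gamma hf1 x)).tendsto_norm hV).add
        ((h2.sub hV (contAt_of_mem_Gamma hf2 x)).tendsto_norm hV)
      exact (hU.mem_nhds hx |> fun h => h : ∀ᶠ z in 𝓝 x, z ∈ U).and (h3.eventually_lt_const hxε)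

end Selections

/-! ### The limit operator -/

section LimitOperator

variable {X : Type*} [TopologicalSpace X] {E : X → Type*} [∀ x, NormedAddCommGroup (E x)]
  {𝕜 : Type*} [RCLike 𝕜] [∀ x, NormedSpace 𝕜 (E x)] {τ : TopologicalSpace (Tot E)}
  {xinf : X} {U₀ : ∀ x, ℝ≥0 → E x →L[𝕜] E x}

theorem mem_limitPhi_iff (hV : IsBanachBundle 𝕜 τ) {φ : ∀ x, E x × E x} :
    φ ∈ limitPhi τ xinf U₀ ↔ ((∃ C : ℝ, ∀ x, ‖φ x‖ ≤ C) ∧ ContAt τ (fun z => (φ z).1) xinf ∧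
      ContAt τ (fun z => (φ z).2) xinf) ∧ ∀ x, x ≠ xinf → φ x ∈ generatorGraph (U₀ x) :=
  and_congr_left' (mem_GammaAt_directSum_iff hV)

theorem limitGraph_self : limitGraph τ xinf U₀ xinf =
    {p | ∃ φ ∈ limitPhi τ xinf U₀, φ xinf = p} := by
  ext p
  simp [limitGraph]

theorem limitGraph_of_ne {x : X} (hx : x ≠ xinf) :
    limitGraph τ xinf U₀ x = generatorGraph (U₀ x) := by
  ext p
  simp [limitGraph, hx]

variable [∀ x, NormedSpace ℝ (E x)] [∀ x, IsScalarTower ℝ 𝕜 (E x)]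

/-- `Φ`, as a linear space. -/
def limitPhiSubmodule (hV : IsBanachBundle 𝕜 τ) (xinf : X) (U₀ : ∀ x, ℝ≥0 → E x →L[𝕜] E x) :
    Submodule 𝕜 (∀ x, E x × E x) where
  carrier := limitPhi τ xinf U₀
  zero_mem' := (mem_limitPhi_iff hV).2 ⟨⟨⟨0, fun x => by simp⟩,
    contAt_of_mem_Gamma (zero_mem_Gamma hV xinf) xinf,
    contAt_of_mem_Gamma (zero_mem_Gamma hV xinf) xinf⟩, fun x _ => generatorGraph_zero_mem _⟩
  add_mem' {φ ψ} hφ hψ := by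
    obtain ⟨⟨⟨C, hC⟩, h1, h2⟩, h3⟩ := (mem_limitPhi_iff hV).1 hφ
    obtain ⟨⟨⟨C', hC'⟩, h1', h2'⟩, h3'⟩ := (mem_limitPhi_iff hV).1 hψ
    exact (mem_limitPhi_iff hV).2 ⟨⟨⟨C + C', fun x =>
      (norm_add_le _ _).trans (add_le_add (hC x) (hC' x))⟩, h1.add hV h1', h2.add hV h2'⟩,
      fun x hx => generatorGraph_add_mem (h3 x hx) (h3' x hx)⟩
  smul_mem' c φ hφ := by
    obtain ⟨⟨⟨C, hC⟩, h1, h2⟩, h3⟩ := (mem_limitPhi_iff hV).1 hφ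
    exact (mem_limitPhi_iff hV).2 ⟨⟨⟨‖c‖ * C, fun x => by
      rw [Pi.smul_apply, norm_smul]; exact mul_le_mul_of_nonneg_left (hC x) (norm_nonneg _)⟩,
      h1.smul hV c, h2.smul hV c⟩, fun x hx => generatorGraph_smul_mem c (h3 x hx)⟩

/-- The graph of the limit operator at `x∞`, as a linear space. -/
def limitOperator (hV : IsBanachBundle 𝕜 τ) (xinf : X) (U₀ : ∀ x, ℝ≥0 → E x →L[𝕜] E x) :
    Submodule 𝕜 (E xinf × E xinf) :=
  (limitPhiSubmodule hV xinf U₀).map (LinearMap.proj xinf)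

theorem coe_limitOperator (hV : IsBanachBundle 𝕜 τ) :
    (limitOperator hV xinf U₀ : Set (E xinf × E xinf)) = limitGraph τ xinf U₀ xinf := by
  rw [limitGraph_self]
  rfl

theorem mem_limitPhi_of_uniform_limit (hV : IsBanachBundle 𝕜 τ)
    (hU₀ : ∀ x, x ≠ xinf → IsC0Semigroup (U₀ x) ∧ ∀ s, ‖U₀ x s‖ ≤ 1) {f : ℕ → ∀ x, E x × E x}
    (hf : ∀ n, f n ∈ limitPhi τ xinf U₀) {r : ℕ → ℝ} (hr : Tendsto r atTop (𝓝 0))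
    {ψ : ∀ x, E x × E x} (hψ : ∀ n x, ‖ψ x - f n x‖ ≤ r n) : ψ ∈ limitPhi τ xinf U₀ := by
  have hf' := fun n => (mem_limitPhi_iff hV).1 (hf n)
  have hev : ∀ ε : ℝ, 0 < ε → ∃ n, ∀ x, ‖ψ x - f n x‖ < ε := fun ε hε => by
    obtain ⟨n, hn⟩ := (hr.eventually_lt_const hε).exists
    exact ⟨n, fun x => (hψ n x).trans_lt hn⟩
  refine (mem_limitPhi_iff hV).2 ⟨⟨?_, ?_, ?_⟩, fun x hx => ?_⟩
  · obtain ⟨C, hC⟩ := (hf' 0).1.1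
    refine ⟨r 0 + C, fun x => ?_⟩
    have := norm_add_le (ψ x - f 0 x) (f 0 x)
    rw [sub_add_cancel] at this
    exact this.trans (add_le_add (hψ 0 x) (hC x))
  · refine ContAt.of_approx fun ε hε => ?_
    obtain ⟨n, hn⟩ := hev ε hε
    exact ⟨_, (hf' n).1.2.1, (norm_fst_le (ψ xinf - f n xinf)).trans_lt (hn xinf),
      Eventually.of_forall fun z => (norm_fst_le (ψ z - f n z)).trans_lt (hn z)⟩
  · refine ContAt.of_approx fun ε hε => ?_
    obtain ⟨n, hn⟩ := hev ε hε
    exact ⟨_, (hf' n).1.2.2, (norm_snd_le (ψ xinf - f n xinf)).trans_lt (hn xinf),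
      Eventually.of_forall fun z => (norm_snd_le (ψ z - f n z)).trans_lt (hn z)⟩
  · have : CompleteSpace (E x) := hV.complete x
    have hcl := isClosed_generatorGraph (hU₀ x hx).1 (hU₀ x hx).2
    refine hcl.mem_of_tendsto (b := atTop) (f := fun n => f n x) ?_
      (Eventually.of_forall fun n => (hf' n).2 x hx)
    rw [tendsto_iff_norm_sub_tendsto_zero]
    refine squeeze_zero (fun n => norm_nonneg _) (fun n => ?_) hr
    rw [norm_sub_rev]
    exact hψ n x

open Classical in
-- The cutoff changes nothing near `x∞`, and elsewhere only membership in the fibrewise graphs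
-- matters, which `0` satisfies.
theorem cutoff_mem_limitPhi (hV : IsBanachBundle 𝕜 τ) {φ : ∀ x, E x × E x}
    (hφ : φ ∈ limitPhi τ xinf U₀) {ε : ℝ} (hε : ‖φ xinf‖ < ε) :
    (fun x => if ‖φ x‖ < ε then φ x else 0) ∈ limitPhi τ xinf U₀ := by
  obtain ⟨⟨⟨C, hC⟩, h1, h2⟩, h3⟩ := (mem_limitPhi_iff hV).1 hφ
  have hε0 : 0 < ε := (norm_nonneg _).trans_lt hε
  have hev : ∀ᶠ z in 𝓝 xinf, ‖φ z‖ < ε := by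
    have h4 := (h1.tendsto_norm hV).eventually_lt_const ((norm_fst_le _).trans_lt hε)
    have h5 := (h2.tendsto_norm hV).eventually_lt_const ((norm_snd_le _).trans_lt hε)
    filter_upwards [h4, h5] with z h6 h7
    rw [Prod.norm_def]
    exact max_lt h6 h7
  refine (mem_limitPhi_iff hV).2 ⟨⟨⟨ε, fun x => ?_⟩, ?_, ?_⟩, fun x hx => ?_⟩
  · split_ifs with h
    · exact h.le
    · simpa using hε0.le
  · refine h1.congr ?_
    filter_upwards [hev] with z hz
    rw [if_pos hz]
  · refine h2.congr ?_
    filter_upwards [hev] with z hz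
    rw [if_pos hz]
  · split_ifs with h
    · exact h3 x hx
    · exact generatorGraph_zero_mem _

theorem isClosed_limitOperator (hV : IsBanachBundle 𝕜 τ)
    (hU₀ : ∀ x, x ≠ xinf → IsC0Semigroup (U₀ x) ∧ ∀ s, ‖U₀ x s‖ ≤ 1) :
    IsClosed (limitOperator hV xinf U₀ : Set (E xinf × E xinf)) := by
  classical
  refine isClosed_of_closure_subset fun p hp => ?_
  have hcomp : ∀ x, CompleteSpace (E x) := hV.complete
  -- These radii keep consecutive differences at `x∞` below `1 / 2 / 2 ^ n`, the cutoff level and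
  -- the form used by the geometric-series lemmas.
  have h1 : ∀ n : ℕ, ∃ φ ∈ limitPhi τ xinf U₀, ‖φ xinf - p‖ < 1 / 4 / 2 ^ n := by
    intro n
    obtain ⟨q, hq, hqp⟩ := Metric.mem_closure_iff.1 hp (1 / 4 / 2 ^ n) (by positivity)
    obtain ⟨φ, hφ, rfl⟩ := hq
    refine ⟨φ, hφ, ?_⟩
    rwa [dist_eq_norm, norm_sub_rev] at hqp
  choose φ hφ hφp using h1
  let δ : ℕ → ∀ x, E x × E x := fun n x =>
    if ‖φ (n + 1) x - φ n x‖ < 1 / 2 / 2 ^ n then φ (n + 1) x - φ n x else 0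
  have hδinf : ∀ n, ‖φ (n + 1) xinf - φ n xinf‖ < 1 / 2 / 2 ^ n := by
    intro n
    have h2 := norm_sub_le_norm_sub_add_norm_sub (φ (n + 1) xinf) p (φ n xinf)
    rw [norm_sub_rev p] at h2
    have h3 : (1 : ℝ) / 4 / 2 ^ (n + 1) ≤ 1 / 4 / 2 ^ n :=
      div_le_div_of_nonneg_left (by norm_num) (by positivity)
        (pow_le_pow_right₀ one_le_two n.le_succ)
    have h4 : (1 : ℝ) / 4 / 2 ^ n + 1 / 4 / 2 ^ n = 1 / 2 / 2 ^ n := by ring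
    linarith [hφp n, hφp (n + 1)]
  have hδ : ∀ n, δ n ∈ limitPhi τ xinf U₀ := fun n =>
    cutoff_mem_limitPhi hV ((limitPhiSubmodule hV xinf U₀).sub_mem (hφ (n + 1)) (hφ n)) (hδinf n)
  let f : ℕ → ∀ x, E x × E x := fun N => φ 0 + ∑ n ∈ Finset.range N, δ n
  have hf : ∀ N, f N ∈ limitPhi τ xinf U₀ := fun N =>
    (limitPhiSubmodule hV xinf U₀).add_mem (hφ 0)
      ((limitPhiSubmodule hV xinf U₀).sum_mem fun n _ => hδ n)
  have hfsucc : ∀ N x, f (N + 1) x = f N x + δ N x := by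
    intro N x
    simp only [f, Finset.sum_range_succ, Pi.add_apply, add_assoc]
  have hfd : ∀ x N, dist (f N x) (f (N + 1) x) ≤ 1 / 2 / 2 ^ N := by
    intro x N
    rw [hfsucc, dist_self_add_right]
    simp only [δ]
    split_ifs with h
    · exact h.le
    · rw [norm_zero]; positivity
  choose ψ hψ using fun x => cauchySeq_tendsto_of_complete (cauchySeq_of_le_geometric_two (hfd x))
  have hψm : ψ ∈ limitPhi τ xinf U₀ := by
    refine mem_limitPhi_of_uniform_limit hV hU₀ hf (r := fun n => 1 / 2 ^ n) ?_ fun n x => ?_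
    · simpa using tendsto_pow_atTop_nhds_zero_of_lt_one (r := (1 / 2 : ℝ)) (by norm_num)
        (by norm_num)
    · rw [← dist_eq_norm, dist_comm]
      exact dist_le_of_le_geometric_two_of_tendsto (hfd x) (hψ x) n
  refine ⟨ψ, hψm, ?_⟩
  change ψ xinf = p
  -- The cutoff is inactive at `x∞`, so the sum telescopes there.
  have hfinf : ∀ N, f N xinf = φ N xinf := by
    intro N
    induction N with
    | zero => simp [f]
    | succ N ih =>
      rw [hfsucc, ih]
      simp only [δ]
      rw [if_pos (hδinf N)]
      abel
  refine tendsto_nhds_unique (hψ xinf) ?_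
  simp only [hfinf]
  rw [tendsto_iff_norm_sub_tendsto_zero]
  refine squeeze_zero (fun n => norm_nonneg _) (fun n => (hφp n).le) ?_
  have := (tendsto_pow_atTop_nhds_zero_of_lt_one (r := (1 / 2 : ℝ)) (by norm_num)
    (by norm_num)).const_mul (1 / 4 : ℝ)
  simpa [div_eq_mul_inv] using this

/-- Both sides of the inequality are continuous at `x∞` along a selection in `Φ`, and the inequality
holds on the punctured neighbourhoods. -/
theorem isDissipative_limitOperator (hV : IsBanachBundle 𝕜 τ) [(𝓝[≠] xinf).NeBot]
    (hU₀ : ∀ x, x ≠ xinf → ∀ s, ‖U₀ x s‖ ≤ 1) : IsDissipative (limitOperator hV xinf U₀) := by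
  rintro _ ⟨φ, hφ, rfl⟩ c hc
  obtain ⟨⟨-, h1, h2⟩, h3⟩ := (mem_limitPhi_iff hV).1 hφ
  have t1 := ((h1.tendsto_norm hV).const_mul c).mono_left (nhdsWithin_le_nhds (s := {xinf}ᶜ))
  have t2 := (((h1.smul hV (c : 𝕜)).sub hV h2).tendsto_norm hV).mono_left
    (nhdsWithin_le_nhds (s := {xinf}ᶜ))
  refine le_of_tendsto_of_tendsto t1 t2 ?_
  filter_upwards [self_mem_nhdsWithin] with z hz
  exact isDissipative_generator (hU₀ z hz) (h3 z hz) hc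

theorem norm_le_norm_add_smul_limitOperator (hV : IsBanachBundle 𝕜 τ) [(𝓝[≠] xinf).NeBot]
    (hU₀ : ∀ x, x ≠ xinf → ∀ s v, ‖U₀ x s v‖ = ‖v‖) {p : E xinf × E xinf}
    (hp : p ∈ limitOperator hV xinf U₀) {h : ℝ} (hh : 0 < h) : ‖p.1‖ ≤ ‖p.1 + h • p.2‖ := by
  obtain ⟨φ, hφ, rfl⟩ := hp
  obtain ⟨⟨-, h1, h2⟩, h3⟩ := (mem_limitPhi_iff hV).1 hφ
  have t1 := (h1.tendsto_norm hV).mono_left (nhdsWithin_le_nhds (s := {xinf}ᶜ))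
  have t2 := ((h1.add hV (h2.smul hV (h : 𝕜))).tendsto_norm hV).mono_left
    (nhdsWithin_le_nhds (s := {xinf}ᶜ))
  rw [RCLike.real_smul_eq_coe_smul (K := 𝕜)]
  refine le_of_tendsto_of_tendsto t1 t2 ?_
  filter_upwards [self_mem_nhdsWithin] with z hz
  rw [← RCLike.real_smul_eq_coe_smul (K := 𝕜)]
  exact norm_le_norm_add_smul (hU₀ z hz) (h3 z hz) hh

/-- The limit operator generates a semigroup. -/
theorem exists_limitSemigroup (hV : IsBanachBundle 𝕜 τ) [(𝓝[≠] xinf).NeBot] {κ : SemigroupKind}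
    (hU₀ : ∀ x, x ≠ xinf → IsC0Semigroup (U₀ x) ∧ κ.Holds (U₀ x))
    (hdom : Dense (Prod.fst '' limitGraph τ xinf U₀ xinf))
    (hrange : κ.RangeCond 𝕜 (limitGraph τ xinf U₀ xinf)) :
    (∃ S : ℝ≥0 → E xinf →L[𝕜] E xinf,
        IsC0Semigroup S ∧ κ.Holds S ∧ generatorGraph S = limitGraph τ xinf U₀ xinf) ∧
      ∀ c : ℝ, 0 < c → ∀ y, ∃ p ∈ limitGraph τ xinf U₀ xinf, (c : 𝕜) • p.1 - p.2 = y := by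
  have hcomp : CompleteSpace (E xinf) := hV.complete xinf
  have hU1 : ∀ x, x ≠ xinf → ∀ s, ‖U₀ x s‖ ≤ 1 := fun x hx => (hU₀ x hx).2.norm_le_one
  have hcl := isClosed_limitOperator hV (xinf := xinf) fun x hx => ⟨(hU₀ x hx).1, hU1 x hx⟩
  have hdis := isDissipative_limitOperator hV hU1
  obtain ⟨c₀, hc₀, hd⟩ : ∃ c₀ : ℝ, 0 < c₀ ∧ Dense (rangeSub 𝕜 c₀ (limitGraph τ xinf U₀ xinf)) := by
    cases κ with
    | contraction => exact hrange
    | isometry =>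
      obtain ⟨c₀, -, hc₀, -, hd, -⟩ := hrange
      exact ⟨c₀, hc₀, hd⟩
  rw [← coe_limitOperator hV] at hdom hd ⊢
  refine ⟨?_, fun c hc => hdis.surjective_of_pos hc₀ (hdis.rangeSub_eq_univ hcl hc₀ hd) hc⟩
  obtain ⟨S, hS, hSc, hSg⟩ := hdis.exists_semigroup hcl hdom hc₀ hd
  refine ⟨S, hS, ?_, hSg⟩
  cases κ with
  | contraction => exact hSc
  | isometry =>
    refine norm_apply_eq_of_norm_le_norm_add_smul hS hSc (hSg ▸ hdom) fun p hp h hh => ?_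
    rw [hSg] at hp
    exact norm_le_norm_add_smul_limitOperator hV (fun x hx => (hU₀ x hx).2) hp hh

theorem isGraphSection_limitGraph (hV : IsBanachBundle 𝕜 τ) [(𝓝[≠] xinf).NeBot]
    {κ : SemigroupKind} (hU₀ : ∀ x, x ≠ xinf → IsC0Semigroup (U₀ x) ∧ κ.Holds (U₀ x))
    (hdom : Dense (Prod.fst '' limitGraph τ xinf U₀ xinf)) :
    IsGraphSection 𝕜 τ (limitGraph τ xinf U₀) xinf (limitPhi τ xinf U₀) where
  graph x := by
    by_cases hx : x = xinf
    · subst hx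
      have hdis := isDissipative_limitOperator hV (xinf := x)
        fun y hy => (hU₀ y hy).2.norm_le_one
      rw [← coe_limitOperator hV] at hdom ⊢
      refine ⟨(limitOperator hV x U₀).toLinearPMap, ?_⟩
      rw [Submodule.toLinearPMap_graph_eq]
      rintro ⟨v, w⟩ hp hv
      obtain rfl : v = 0 := hv
      exact hdis.eq_zero_of_mem hdom hp
    · rw [limitGraph_of_ne hx]
      let G : Submodule 𝕜 (E x × E x) :=
        { carrier := generatorGraph (U₀ x)
          zero_mem' := generatorGraph_zero_mem _
          add_mem' := generatorGraph_add_mem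
          smul_mem' := fun c _ hp => generatorGraph_smul_mem c hp }
      refine ⟨G.toLinearPMap, ?_⟩
      rw [Submodule.toLinearPMap_graph_eq]
      · rfl
      rintro ⟨v, w⟩ hp hv
      obtain rfl : v = 0 := hv
      exact generatorGraph_unique hp (generatorGraph_zero_mem (U₀ x))
  subset φ hφ := hφ.1
  linear := ⟨limitPhiSubmodule hV xinf U₀, rfl⟩
  inclusion x φ hφ := by
    by_cases hx : x = xinf
    · subst hx
      rw [limitGraph_self]
      exact ⟨φ, hφ, rfl⟩
    · rw [limitGraph_of_ne hx]
      exact hφ.2 x hx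
  asymptotic := limitGraph_self.symm

end LimitOperator

/-! ### Convergence of the semigroups -/

section Convergence

variable {X : Type*} [TopologicalSpace X] {E : X → Type*} [∀ x, NormedAddCommGroup (E x)]
  {𝕜 : Type*} [RCLike 𝕜] [∀ x, NormedSpace 𝕜 (E x)] {τ : TopologicalSpace (Tot E)}
  {xinf : X} {U₀ : ∀ x, ℝ≥0 → E x →L[𝕜] E x}

theorem selIn_singleton {X : Type*} {E : X → Type*} {ℰ : Set (∀ x, E x)} {w : ∀ x, E x} (hw : w ∈ ℰ) :
    selIn ℰ (fun x => {w x}) = {w} := by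
  ext v
  simp only [selIn, mem_ofPred_eq, mem_singleton_iff]
  exact ⟨fun h => funext h.2, by rintro rfl; exact ⟨hw, fun _ => rfl⟩⟩

theorem valuesIn_singleton {X : Type*} {E : X → Type*} {ℰ : Set (∀ x, E x)} {w : ∀ x, E x} (hw : w ∈ ℰ) (x : X) :
    valuesIn ℰ (fun x => {w x}) x = {w x} := by
  ext y
  simp only [valuesIn, selIn_singleton hw]
  simp [eq_comm]

theorem singleton_mem_boundedFamily {v : ∀ x, E x} (hv : v ∈ limitE τ xinf U₀) (x : X) :
    {v x} ∈ boundedFamily (limitE τ xinf U₀) (limitTheta τ xinf U₀) x :=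
  ⟨_, ⟨v, hv, rfl⟩, (valuesIn_singleton hv x).symm⟩

theorem boundedFamily_singletons {x : X} :
    ∀ b ∈ boundedFamily (limitE τ xinf U₀) (limitTheta τ xinf U₀) x, ∃ y, b = {y} := by
  rintro _ ⟨_, ⟨w, hw, rfl⟩, rfl⟩
  exact ⟨w x, valuesIn_singleton hw x⟩

theorem withSeminorms_singleton_normSeminorm (𝕜 E : Type*) [RCLike 𝕜] [NormedAddCommGroup E]
    [NormedSpace 𝕜 E] :
    WithSeminorms (fun p : ({normSeminorm 𝕜 E} : Set (Seminorm 𝕜 E)) => (p : Seminorm 𝕜 E)) := by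
  have h := norm_withSeminorms 𝕜 E
  have e : (fun p : ({normSeminorm 𝕜 E} : Set (Seminorm 𝕜 E)) => (p : Seminorm 𝕜 E)) =
      fun _ => normSeminorm 𝕜 E := funext fun p => p.2
  rw [e]
  exact h.congr_equiv (Equiv.ofUnique _ _)

/-- In the isometric case the norm alone serves as the preserved defining family of seminorms. -/
theorem mem_semigroups {E : Type*} [NormedAddCommGroup E] [NormedSpace 𝕜 E] {κ : SemigroupKind}
    {U : ℝ≥0 → E →L[𝕜] E} (hU : IsC0Semigroup U) (hκ : κ.Holds U) {𝔖 : Set (Set E)}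
    (h𝔖 : ∀ b ∈ 𝔖, ∃ y, b = {y}) : U ∈ κ.semigroups 𝕜 𝔖 := by
  have h : U ∈ contSemigroups 𝕜 𝔖 :=
    ⟨hU.map_zero, hU.map_add, continuous_toLS_of_singletons h𝔖 hU.continuous⟩
  cases κ with
  | contraction => exact ⟨h, hκ⟩
  | isometry =>
    refine ⟨h, {normSeminorm 𝕜 E}, withSeminorms_singleton_normSeminorm 𝕜 E, ?_⟩
    rintro _ rfl s v
    exact hκ s v

theorem sn_mapBundle_le {X : Type*} {E : X → Type*} [∀ x, NormedAddCommGroup (E x)]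
    [∀ x, NormedSpace 𝕜 (E x)] {M : ∀ x, Submodule 𝕜 (ℝ≥0 → E x →L[𝕜] E x)}
    {γ : TopologicalSpace (Tot fun x => M x)} {ℰ : Set (∀ x, E x)} {Θ : Set (∀ x, Set (E x))}
    {O : Finset (TopologicalSpace.Compacts ℝ≥0 × Θ)} {x : X} {f : M x} {C : ℝ} (hC : 0 ≤ C)
    (h : ∀ o ∈ O, ∀ t ∈ o.1, ∀ v ∈ selIn ℰ (o.2 : ∀ x, Set (E x)),
      ‖(f : ℝ≥0 → E x →L[𝕜] E x) t (v x)‖ ≤ C) : (mapBundle ℰ Θ M γ).sn O x f ≤ C := by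
  refine Real.sSup_le ?_ hC
  rintro _ ⟨o, ho, t, ht, v, hv, rfl⟩
  exact h o ho t ht v hv

variable [∀ x, NormedSpace ℝ (E x)] [∀ x, IsScalarTower ℝ 𝕜 (E x)]

/-- The Laplace transforms of the orbits `U z (φ z).1`, for `φ ∈ Φ`, are continuous at `x∞`. -/
theorem tendsto_laplace_orbit (hV : IsBanachBundle 𝕜 τ) {U : ∀ x, ℝ≥0 → E x →L[𝕜] E x}
    (hU : ∀ x, IsC0Semigroup (U x)) (hUc : ∀ x s, ‖U x s‖ ≤ 1)
    (hUne : ∀ x, x ≠ xinf → U x = U₀ x)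
    (hUinf : generatorGraph (U xinf) = limitGraph τ xinf U₀ xinf) {c : ℝ} (hc : 0 < c)
    (hsurj : ∀ y, ∃ p ∈ limitGraph τ xinf U₀ xinf, (c : 𝕜) • p.1 - p.2 = y)
    {w : ∀ x, E x} (hw : ContAt τ w xinf) {q : ∀ x, E x} (hq : ContAt τ q xinf)
    (hqw : q xinf = ∫ s in Ioi (0 : ℝ), Real.exp (-(c * s)) • orbit (U xinf) (w xinf) s) :
    Tendsto (fun z => ‖(∫ s in Ioi (0 : ℝ), Real.exp (-(c * s)) • orbit (U z) (w z) s) - q z‖)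
      (𝓝 xinf) (𝓝 0) := by
  have hcomp : ∀ x, CompleteSpace (E x) := hV.complete
  -- Surjectivity at `x∞` provides `ψ ∈ Φ` such that `c ψ₁ - ψ₂` agrees with `w` at `x∞`. Its
  -- Laplace transform is `ψ₁` in every fibre.
  obtain ⟨p, hp, hpw⟩ := hsurj (w xinf)
  rw [limitGraph_self] at hp
  obtain ⟨ψ, hψ, rfl⟩ := hp
  obtain ⟨⟨-, h1, h2⟩, h3⟩ := (mem_limitPhi_iff hV).1 hψ
  have hgen : ∀ z, ψ z ∈ generatorGraph (U z) := by
    intro z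
    by_cases hz : z = xinf
    · subst hz
      rw [hUinf, limitGraph_self]
      exact ⟨ψ, hψ, rfl⟩
    · rw [hUne z hz]
      exact h3 z hz
  have hlap : ∀ z, ∫ s in Ioi (0 : ℝ), Real.exp (-(c * s)) •
      orbit (U z) ((c : 𝕜) • (ψ z).1 - (ψ z).2) s = (ψ z).1 := fun z => by
    rw [← RCLike.real_smul_eq_coe_smul (K := 𝕜)]
    exact integral_exp_smul_orbit (hU z) (hUc z) (hgen z) hc
  have hint : ∀ z v, IntegrableOn (fun s => Real.exp (-(c * s)) • orbit (U z) v s) (Ioi 0) :=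
    fun z v => integrableOn_exp_smul_of_bounded ((hU z).continuous_orbit v)
      (fun s _ => norm_orbit_le (hUc z) v s) hc
  have hr := hw.sub hV ((h1.smul hV (c : 𝕜)).sub hV h2)
  have hr' := (hr.tendsto_norm hV).div_const c
  have hs' := (h1.sub hV hq).tendsto_norm hV
  have hq0 : (ψ xinf).1 - q xinf = 0 := by
    rw [hqw, ← hpw, hlap, sub_self]
  simp only [hpw, hq0, sub_self, norm_zero, zero_div] at hr' hs'
  have hsum := hr'.add hs'
  rw [add_zero] at hsum
  refine squeeze_zero (fun z => norm_nonneg _) (fun z => ?_) hsum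
  have e : (∫ s in Ioi (0 : ℝ), Real.exp (-(c * s)) • orbit (U z) (w z) s) - q z =
      (∫ s in Ioi (0 : ℝ), Real.exp (-(c * s)) •
        orbit (U z) (w z - ((c : 𝕜) • (ψ z).1 - (ψ z).2)) s) + ((ψ z).1 - q z) := by
    have e1 : ∀ s, Real.exp (-(c * s)) • orbit (U z) (w z - ((c : 𝕜) • (ψ z).1 - (ψ z).2)) s =
        Real.exp (-(c * s)) • orbit (U z) (w z) s -
          Real.exp (-(c * s)) • orbit (U z) ((c : 𝕜) • (ψ z).1 - (ψ z).2) s := by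
      intro s
      rw [← smul_sub]
      simp only [orbit, map_sub]
    simp only [e1]
    rw [integral_sub (hint z _) (hint z _), hlap]
    abel
  rw [e]
  refine (norm_add_le _ _).trans (add_le_add ?_ le_rfl)
  exact norm_integral_exp_smul_le (fun s _ => norm_orbit_le (hUc z) _ s) hc

/-- A bounded equicontinuous sequence of vector-valued functions that tends to zero pointwise
tends to zero uniformly on compact sets. -/
theorem eventually_norm_le_of_equicontinuous {F : ℕ → Type*} [∀ n, NormedAddCommGroup (F n)]
    {f : ∀ n, ℝ≥0 → F n}
    (heq : ∀ s₀ : ℝ≥0, ∀ ε : ℝ, 0 < ε → ∃ W ∈ 𝓝 s₀, ∀ s ∈ W, ∀ n, ‖f n s - f n s₀‖ ≤ ε)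
    (hlim : ∀ s, Tendsto (fun n => ‖f n s‖) atTop (𝓝 0)) {K : Set ℝ≥0} (hK : IsCompact K) {ε : ℝ}
    (hε : 0 < ε) : ∀ᶠ n in atTop, ∀ s ∈ K, ‖f n s‖ ≤ ε := by
  refine hK.induction_on (p := fun K => ∀ᶠ n in atTop, ∀ s ∈ K, ‖f n s‖ ≤ ε) (by simp)
    (fun s t hst ht => ht.mono fun n hn r hr => hn r (hst hr))
    (fun s t hs ht => (hs.and ht).mono fun n hn r hr => hr.elim (hn.1 r) (hn.2 r)) fun s₀ _ => ?_
  obtain ⟨W, hW, hWε⟩ := heq s₀ (ε / 2) (by positivity)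
  refine ⟨W, mem_nhdsWithin_of_mem_nhds hW, ?_⟩
  filter_upwards [(hlim s₀).eventually_lt_const (half_pos hε)] with n hn s hs
  have h1 := hWε s hs n
  have h2 := norm_add_le (f n s - f n s₀) (f n s₀)
  rw [sub_add_cancel] at h2
  linarith

/-- The core of the convergence: a sequence violating uniform smallness would be bounded and
equicontinuous with vanishing Laplace transforms, hence would converge to zero uniformly on `K`. -/
theorem eventually_norm_sub_le (hV : IsBanachBundle 𝕜 τ) [(𝓝 xinf).IsCountablyGenerated]
    {U : ∀ x, ℝ≥0 → E x →L[𝕜] E x}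
    (hU : ∀ x, IsC0Semigroup (U x)) (hUc : ∀ x s, ‖U x s‖ ≤ 1)
    (hUne : ∀ x, x ≠ xinf → U x = U₀ x)
    (hUinf : generatorGraph (U xinf) = limitGraph τ xinf U₀ xinf)
    (hsurj : ∀ c : ℝ, 0 < c → ∀ y, ∃ p ∈ limitGraph τ xinf U₀ xinf, (c : 𝕜) • p.1 - p.2 = y)
    {𝔖 : ∀ x, Set (Set (E x))} {F : ∀ x, ℝ≥0 → E x →L[𝕜] E x}
    (hFc : ∀ x, Continuous fun t => toLS (𝔖 x) (F x t)) (hFinf : F xinf = U xinf)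
    (hFL : ∀ x (c : ℝ), 0 < c → ∃ A, HasLaplace (𝔖 x) (F x) c A)
    {v φ : ∀ x, E x} (hv : ContAt τ v xinf) (hv𝔖 : ∀ x, {v x} ∈ 𝔖 x) (hφ : ContAt τ φ xinf)
    (hφv : φ xinf = v xinf)
    (hLD : ∀ c : ℝ, 0 < c → ContAt τ (fun z => laplace (𝔖 z) (F z) c (v z)) xinf)
    (heq : ∀ z : ℕ → X, Tendsto z atTop (𝓝 xinf) →
      IsBoundedEquicontinuous (fun x s => U x s (φ x) - F x s (v x)) z)
    {K : Set ℝ≥0} (hK : IsCompact K) {ε : ℝ} (hε : 0 < ε) :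
    ∀ᶠ z in 𝓝 xinf, ∀ s ∈ K, ‖U z s (v z) - F z s (v z)‖ ≤ ε := by
  have hcomp : ∀ x, CompleteSpace (E x) := hV.complete
  have hFv : ∀ x, Continuous fun s => F x s (v x) := fun x =>
    continuous_apply_of_continuous_toLS (hv𝔖 x) rfl (hFc x)
  -- Boundedness of the difference bounds `F x s (v x)` in `s`, so the weak Laplace integral is a
  -- Bochner integral at `v x`.
  have hlapF : ∀ x, (∃ C : ℝ, ∀ s, ‖U x s (φ x) - F x s (v x)‖ ≤ C) → ∀ c : ℝ, 0 < c →
      laplace (𝔖 x) (F x) c (v x) =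
        ∫ s in Ioi (0 : ℝ), Real.exp (-(c * s)) • F x s.toNNReal (v x) := by
    rintro x ⟨C, hC⟩ c hc
    refine (hasLaplace_laplace (hFL x c hc)).apply_eq_integral (hv𝔖 x) rfl ?_
    refine integrableOn_exp_smul_of_bounded ((hFv x).comp continuous_real_toNNReal)
      (C := ‖φ x‖ + C) (fun s _ => ?_) hc
    have h1 := norm_sub_le (U x s.toNNReal (φ x)) (U x s.toNNReal (φ x) - F x s.toNNReal (v x))
    rw [sub_sub_cancel] at h1
    exact h1.trans (add_le_add (norm_apply_le_of_norm_le_one (hUc x _) _) (hC _))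
  have hLinf : ∀ c : ℝ, 0 < c → laplace (𝔖 xinf) (F xinf) c (v xinf) =
      ∫ s in Ioi (0 : ℝ), Real.exp (-(c * s)) • orbit (U xinf) (φ xinf) s := by
    intro c hc
    rw [hlapF xinf ⟨0, fun s => by rw [hFinf, hφv, sub_self, norm_zero]⟩ c hc, hφv, hFinf]
    rfl
  have key : ∀ᶠ z in 𝓝 xinf, ∀ s ∈ K, ‖U z s (φ z) - F z s (v z)‖ ≤ ε / 2 := by
    by_contra hcon
    obtain ⟨z, hz, hzK⟩ := exists_seq_forall_of_frequently (not_eventually.1 hcon)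
    obtain ⟨⟨C, hC⟩, hec⟩ := heq z hz
    set f : ∀ n, ℝ≥0 → E (z n) := fun n s => U (z n) s (φ (z n)) - F (z n) s (v (z n)) with hf
    have hfc : ∀ n, Continuous (f n) := fun n => ((hU (z n)).continuous _).sub (hFv (z n))
    have hL : ∀ c : ℝ, 0 < c → Tendsto (fun n =>
        ‖∫ s in Ioi (0 : ℝ), Real.exp (-(c * s)) • f n s.toNNReal‖) atTop (𝓝 0) := by
      intro c hc
      have h1 := (tendsto_laplace_orbit hV hU hUc hUne hUinf hc (hsurj c hc) hφ (hLD c hc)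
        (hLinf c hc)).comp hz
      refine h1.congr fun n => ?_
      simp only [Function.comp]
      congr 1
      rw [hlapF (z n) ⟨C, hC n⟩ c hc]
      have i1 : IntegrableOn (fun s => Real.exp (-(c * s)) • orbit (U (z n)) (φ (z n)) s)
          (Ioi 0) := integrableOn_exp_smul_of_bounded ((hU (z n)).continuous_orbit _)
            (fun s _ => norm_orbit_le (hUc (z n)) _ s) hc
      have i2 : IntegrableOn (fun s : ℝ => Real.exp (-(c * s)) • f n s.toNNReal) (Ioi 0) :=
        integrableOn_exp_smul_of_bounded ((hfc n).comp continuous_real_toNNReal)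
          (fun s _ => hC n _) hc
      have e : (∫ s in Ioi (0 : ℝ), Real.exp (-(c * s)) • F (z n) s.toNNReal (v (z n))) =
          (∫ s in Ioi (0 : ℝ), Real.exp (-(c * s)) • orbit (U (z n)) (φ (z n)) s) -
          ∫ s in Ioi (0 : ℝ), Real.exp (-(c * s)) • f n s.toNNReal := by
        rw [← integral_sub i1 i2]
        refine integral_congr_ae (Eventually.of_forall fun s => ?_)
        simp only [hf, orbit, ← smul_sub, sub_sub_cancel]
      rw [e, sub_sub_cancel]
    have hlim : ∀ s, Tendsto (fun n => ‖f n s‖) atTop (𝓝 0) := by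
      intro s₀
      have h1 := tendsto_of_tendsto_laplace (f := fun n s => f n s.toNNReal)
        (fun n => (hfc n).comp continuous_real_toNNReal) (fun n s => hC n _) hL s₀.coe_nonneg
        (fun ε hε => by
          rw [Real.toNNReal_coe]
          obtain ⟨W, hW, hWε⟩ := hec s₀ ε hε
          have h2 : ∀ᶠ s : ℝ in 𝓝 (s₀ : ℝ), s.toNNReal ∈ W := by
            have := (continuous_real_toNNReal.tendsto (s₀ : ℝ))
            rw [Real.toNNReal_coe] at this
            exact this hW
          obtain ⟨δ, hδ, h3⟩ := Metric.eventually_nhds_iff.1 h2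
          exact ⟨δ, hδ, fun s hs n => hWε _ (h3 (by rwa [Real.dist_eq])) n⟩)
      simpa only [Real.toNNReal_coe] using h1
    obtain ⟨n, hn⟩ := (eventually_norm_le_of_equicontinuous hec hlim hK (half_pos hε)).exists
    exact hzK n hn
  -- Passing from `φ` to `v` costs at most `‖v z - φ z‖`, because `U z s` is a contraction.
  have hd := (hv.sub hV hφ).tendsto_norm hV
  rw [hφv, sub_self, norm_zero] at hd
  filter_upwards [key, hd.eventually_lt_const (half_pos hε)] with z h1 h2 s hs
  have h3 := norm_add_le (U z s (v z - φ z)) (U z s (φ z) - F z s (v z))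
  rw [map_sub, sub_add_sub_cancel, ← map_sub] at h3
  have h4 := norm_apply_le_of_norm_le_one (hUc z s) (v z - φ z)
  have h5 := h1 s hs
  linarith

end Convergence

/-- A real scalar multiplication compatible with a given one. -/
theorem isScalarTower_restrictScalars (𝕜 E : Type*) [RCLike 𝕜] [NormedAddCommGroup E]
    [NormedSpace 𝕜 E] :
    @IsScalarTower ℝ 𝕜 E _ _ (NormedSpace.restrictScalars ℝ 𝕜 E).toModule.toSMul := by
  let _ : NormedSpace ℝ E := NormedSpace.restrictScalars ℝ 𝕜 E
  refine ⟨fun r c v => ?_⟩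
  change (r • c) • v = (algebraMap ℝ 𝕜 r) • c • v
  rw [Algebra.smul_def, mul_smul]

end OmegaBundle

/-! ### Assembly of the theorem -/

theorem mainTheorem2 {𝕜 : Type*} [RCLike 𝕜] {X : Type*} [TopologicalSpace X]
    {E : X → Type*} [∀ x, NormedAddCommGroup (E x)] [∀ x, NormedSpace 𝕜 (E x)]
    (τ : TopologicalSpace (Tot E)) (hV : IsBanachBundle 𝕜 τ)
    (xinf : X) (hxinf : (𝓝[≠] xinf).NeBot)
    (κ : SemigroupKind) (U₀ : ∀ x, ℝ≥0 → E x →L[𝕜] E x)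
    (hU₀ : ∀ x, x ≠ xinf → IsC0Semigroup (U₀ x) ∧ κ.Holds (U₀ x))
    (hdom : Dense (Prod.fst '' limitGraph τ xinf U₀ xinf))
    (hrange : κ.RangeCond 𝕜 (limitGraph τ xinf U₀ xinf)) :
    (IsGraphSection 𝕜 τ (limitGraph τ xinf U₀) xinf (limitPhi τ xinf U₀) ∧
      ∃ S : ℝ≥0 → E xinf →L[𝕜] E xinf,
        IsC0Semigroup S ∧ κ.Holds S ∧ generatorGraph S = limitGraph τ xinf U₀ xinf) ∧
    ((∀ x, x ≠ xinf → Dense {w : E x | ∃ v ∈ limitE τ xinf U₀, v x = w}) →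
      ∀ (M : ∀ x, Submodule 𝕜 (ℝ≥0 → E x →L[𝕜] E x)) (γ : TopologicalSpace (Tot fun x => M x)),
      IsThetaStructure τ (limitE τ xinf U₀) (limitTheta τ xinf U₀) M γ →
      (∀ x, ∀ f ∈ M x, ∀ c : ℝ, 0 < c →
        ∃ A, HasLaplace (boundedFamily (limitE τ xinf U₀) (limitTheta τ xinf U₀) x) f c A) →
      (∀ z, κ.semigroups 𝕜 (boundedFamily (limitE τ xinf U₀) (limitTheta τ xinf U₀) z) ⊆ M z) →
      ∀ U : ∀ x, ℝ≥0 → E x →L[𝕜] E x,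
      (∀ x, x ≠ xinf → U x = U₀ x) →
      IsC0Semigroup (U xinf) → generatorGraph (U xinf) = limitGraph τ xinf U₀ xinf →
      ∀ F ∈ (mapBundle (limitE τ xinf U₀) (limitTheta τ xinf U₀) M γ).Gamma,
      (F xinf : ℝ≥0 → E xinf →L[𝕜] E xinf) = U xinf →
      (LDAt τ (limitE τ xinf U₀) (limitTheta τ xinf U₀) M γ xinf {F} (limitE τ xinf U₀) ∨
        LDFull τ (limitE τ xinf U₀) (limitTheta τ xinf U₀) M {F} (limitE τ xinf U₀)) →
      (∀ v ∈ limitE τ xinf U₀, ∃ φ ∈ limitPhi τ xinf U₀, (φ xinf).1 = v xinf ∧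
        ∀ z : ℕ → X, Tendsto z atTop (𝓝 xinf) →
          IsBoundedEquicontinuous
            (fun x s => U x s (φ x).1 - (F x : ℝ≥0 → E x →L[𝕜] E x) s (v x)) z) →
      TopologicalSpace.MetrizableSpace X →
      ∃ hU : ∀ x, U x ∈ M x,
        (∀ v ∈ limitE τ xinf U₀, ∀ K : Set ℝ≥0, IsCompact K →
          Tendsto (fun z => ⨆ s : K, ‖U z s (v z) - (F z : ℝ≥0 → E z →L[𝕜] E z) s (v z)‖)
            (𝓝 xinf) (𝓝 0)) ∧
        (fun x => (⟨U x, hU x⟩ : M x)) ∈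
          (mapBundle (limitE τ xinf U₀) (limitTheta τ xinf U₀) M γ).GammaAt xinf ∧
        {(limitGraph τ xinf U₀, xinf, limitPhi τ xinf U₀)} ∈
          DeltaClass τ (limitE τ xinf U₀) (limitTheta τ xinf U₀) M γ) := by
  -- Calculus and integration of orbits use the underlying real structure of the stalks.
  let _ : ∀ x, NormedSpace ℝ (E x) := fun x => NormedSpace.restrictScalars ℝ 𝕜 (E x)
  have _ : ∀ x, IsScalarTower ℝ 𝕜 (E x) := fun x => isScalarTower_restrictScalars 𝕜 (E x)
  have hgraph := isGraphSection_limitGraph hV hU₀ hdom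
  obtain ⟨⟨S, hS, hSκ, hSg⟩, hsurj⟩ := exists_limitSemigroup hV hU₀ hdom hrange
  refine ⟨⟨hgraph, S, hS, hSκ, hSg⟩, ?_⟩
  intro _ M γ hW hLap hsub U hUne hUinf hUg F hF hFinf hLD heq hmet
  -- A semigroup is determined by its generator, so the given `U xinf` inherits contractivity or
  -- isometry from `S`.
  have hUS : U xinf = S := eq_of_generatorGraph_subset hUinf hS hSκ.norm_le_one (hUg ▸ hdom)
    (by rw [hUg, hSg])
  have hU : ∀ x, IsC0Semigroup (U x) ∧ κ.Holds (U x) := by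
    intro x
    by_cases hx : x = xinf
    · subst hx
      rw [hUS]
      exact ⟨hS, hSκ⟩
    · rw [hUne x hx]
      exact hU₀ x hx
  have hUc : ∀ x s, ‖U x s‖ ≤ 1 := fun x => (hU x).2.norm_le_one
  have hUM : ∀ x, U x ∈ M x := fun x =>
    hsub x (mem_semigroups (hU x).1 (hU x).2 boundedFamily_singletons)
  have hconv : ∀ v ∈ limitE τ xinf U₀, ∀ K : Set ℝ≥0, IsCompact K → ∀ ε : ℝ, 0 < ε →
      ∀ᶠ z in 𝓝 xinf, ∀ s ∈ K,
        ‖U z s (v z) - (F z : ℝ≥0 → E z →L[𝕜] E z) s (v z)‖ ≤ ε := by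
    intro v hv K hK ε hε
    obtain ⟨φ, hφ, hφv, hφeq⟩ := heq v hv
    have hv' : v ∈ (normed τ).GammaAt xinf :=
      (mem_GammaAt_iff hV).2 ⟨isBdd_normed.1 hv.1.1, contAt_of_mem_Gamma hv.1 xinf⟩
    refine eventually_norm_sub_le hV (fun x => (hU x).1) hUc hUne hUg hsurj
      (fun x => hW.continuous_mem x _ (F x).2) hFinf (fun x c hc => hLap x _ (F x).2 c hc)
      (contAt_of_mem_Gamma hv.1 xinf) (singleton_mem_boundedFamily hv)
      ((mem_limitPhi_iff hV).1 hφ).1.2.1 hφv (fun c hc => ?_) hφeq hK hε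
    rcases hLD with hLD | hLD
    · refine ((mem_GammaAt_iff hV).1 (hLD c hc F ⟨hF.1, ?_⟩ ⟨F, rfl, rfl⟩ v hv' ⟨v, hv, rfl⟩)).2
      let _ : TopologicalSpace (Tot fun x => M x) := γ
      have h1 : Continuous (graphMap F) := hF.2
      exact h1.continuousAt
    · exact contAt_of_mem_Gamma (hLD c hc F rfl v hv) xinf
  have hUΓ : (fun x => (⟨U x, hUM x⟩ : M x)) ∈
      (mapBundle (limitE τ xinf U₀) (limitTheta τ xinf U₀) M γ).GammaAt xinf := by
    refine ⟨fun O => ?_, ?_⟩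
    · have hb : ∀ o : TopologicalSpace.Compacts ℝ≥0 × limitTheta τ xinf U₀, ∃ C : ℝ, 0 ≤ C ∧
          ∀ v ∈ selIn (limitE τ xinf U₀) (o.2 : ∀ x, Set (E x)), ∀ x, ‖v x‖ ≤ C := by
        rintro ⟨-, _, w, hw, rfl⟩
        obtain ⟨C, hC⟩ := isBdd_normed.1 hw.1.1
        refine ⟨C, (norm_nonneg _).trans (hC xinf), fun v hv x => ?_⟩
        have hvw : v x = w x := hv.2 x
        rw [hvw]
        exact hC x
      choose C hC0 hC using hb
      refine ⟨∑ o ∈ O, C o, ?_⟩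
      rintro _ ⟨x, rfl⟩
      refine sn_mapBundle_le (Finset.sum_nonneg fun o _ => hC0 o) fun o ho t _ v hv => ?_
      exact ((norm_apply_le_of_norm_le_one (hUc x t) _).trans (hC o v hv x)).trans
        (Finset.single_le_sum (fun o _ => hC0 o) ho)
    · intro s hs
      have e : graphMap (fun x => (⟨U x, hUM x⟩ : M x)) xinf = graphMap F xinf := by
        simp only [graphMap]
        congr 1
        exact Subtype.ext hFinf.symm
      rw [e] at hs
      obtain ⟨O, σ, ε, j, hO, hσ, hε, ⟨hxO, hxε⟩, hsubs⟩ :=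
        (hW.isOmegaBundle_maps.nhds_iff _ _).1 hs
      obtain ⟨p, hp⟩ := hW.isOmegaBundle_maps.seminorms
      -- `F` stays in the tube of radius `η < ε`; the gap `ε - η` absorbs the difference between `U`
      -- and `F`.
      obtain ⟨η, hη1, hη2⟩ := exists_between hxε
      have hη0 : 0 < η := by
        refine lt_of_le_of_lt ?_ hη1
        rw [← hp]
        exact apply_nonneg _ _
      have hFη : ∀ᶠ z in 𝓝 xinf, graphMap F z ∈
          tube (mapBundle (limitE τ xinf U₀) (limitTheta τ xinf U₀) M γ).sn O σ η j := by
        let _ : TopologicalSpace (Tot fun x => M x) := γ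
        have h1 : Continuous (graphMap F) := hF.2
        exact h1.continuousAt ((hW.isOmegaBundle_maps.nhds_iff _ _).2
          ⟨O, σ, η, j, hO, hσ, hη0, ⟨hxO, hη1⟩, Subset.rfl⟩)
      have hdiff : ∀ᶠ z in 𝓝 xinf, (mapBundle (limitE τ xinf U₀) (limitTheta τ xinf U₀) M γ).sn j z
          ((⟨U z, hUM z⟩ : M z) - F z) ≤ (ε - η) / 2 := by
        have h1 : ∀ o ∈ j, ∀ᶠ z in 𝓝 xinf, ∀ t ∈ o.1,
            ∀ v ∈ selIn (limitE τ xinf U₀) (o.2 : ∀ x, Set (E x)),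
            ‖U z t (v z) - (F z : ℝ≥0 → E z →L[𝕜] E z) t (v z)‖ ≤ (ε - η) / 2 := by
          rintro ⟨K, _, w, hw, rfl⟩ -
          filter_upwards [hconv w hw K K.isCompact ((ε - η) / 2) (by linarith)] with z hz t ht v hv
          have hvw : v z = w z := hv.2 z
          rw [hvw]
          exact hz t ht
        filter_upwards [(Finset.eventually_all j).2 h1] with z hz
        exact sn_mapBundle_le (by linarith) fun o ho t ht v hv => hz o ho t ht v hv
      have hev : ∀ᶠ z in 𝓝 xinf, graphMap (fun x => (⟨U x, hUM x⟩ : M x)) z ∈ s := by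
        filter_upwards [hFη, hdiff] with z h1 h2
        refine hsubs ⟨h1.1, ?_⟩
        have h3 := h1.2
        change (mapBundle (limitE τ xinf U₀) (limitTheta τ xinf U₀) M γ).sn j z (F z - σ z) < η
          at h3
        change (mapBundle (limitE τ xinf U₀) (limitTheta τ xinf U₀) M γ).sn j z
          ((⟨U z, hUM z⟩ : M z) - σ z) < ε
        rw [← hp] at h2 h3 ⊢
        have h4 := map_add_le_add (p j z) ((⟨U z, hUM z⟩ : M z) - F z) (F z - σ z)
        rw [sub_add_sub_cancel] at h4
        linarith
      exact hev
  refine ⟨hUM, fun v hv K hK => ?_, hUΓ, ?_⟩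
  · rw [Metric.tendsto_nhds]
    intro ε hε
    filter_upwards [hconv v hv K hK (ε / 2) (half_pos hε)] with z hz
    rw [Real.dist_eq, sub_zero, abs_of_nonneg (Real.iSup_nonneg fun _ => norm_nonneg _)]
    exact (Real.iSup_le (fun s : K => hz s.1 s.2) (half_pos hε).le).trans_lt (half_lt_self hε)
  · rintro _ rfl
    refine ⟨hgraph, _, hUΓ, fun x => ⟨(hU x).1, ⟨1, hUc x⟩, ?_⟩⟩
    by_cases hx : x = xinf
    · subst hx
      exact hUg.symm
    · change limitGraph τ xinf U₀ x = generatorGraph (U x)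
      rw [limitGraph_of_ne hx, hUne x hx]
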